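/- Let $k$ be an algebraically closed field. A \emph{tree of smooth rational curves} over $k$ is a connected nodal curve whose irreducible components are each isomorphic to $\mathbb{P}^1$ and whose dual graph is a finite tree; the degree of a line bundle on it is the sum of its degrees on the components. An \emph{enlargement} of $C$ is a surjective morphism $f:C'\to C$ of trees of smooth rational curves whose restriction to every irreducible component of $C'$ is constant or an isomorphism onto a component of $C$. We say that $f$ \emph{inserts $\mathbb{P}^1$'s at nodes} if every fibre of $f$ is a single point, except that the fibre over a node of $C$ may instead be one irreducible component of $C'$. Lemma. Let $C$ be a tree of smooth rational curves over $k$ and $E$ a vector bundle on $C$ such that $H^0(C,E\otimes L)\neq 0$ for every line bundle $L$ of degree $0$ on $C$, but $H^0(C,E\otimes L)=0$ for some line bundle $L$ of degree $-1$ on $C$. Then there is an enlargement $f:C'\to C$, which inserts $\mathbb{P}^1$'s at nodes, such that $f^*E$ has a line subbundle of degree at least $0$ (a line bundle $L$ on $C'$ of degree at least $0$ with a morphism of vector bundles $L\to f^*E$ that is injective on every fibre). -/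

import Mathlib

open Topology TensorProduct

universe u

/-! Curves over the algebraically closed field `k` are treated as classical varieties: a set of
(closed) points with its Zariski topology and its regular functions. -/

/-- The (closed points of the) projective line over `k`: lines through the origin in `k²`. -/
def P1 (k : Type u) [Field k] : Type u := Projectivization k (Fin 2 → k)

namespace P1

variable {k : Type u} [Field k]

/-- The point of the projective line with homogeneous coordinates `x`. -/
def mk (x : Fin 2 → k) (hx : x ≠ 0) : P1 k := Projectivization.mk k x hx

/-- The Zariski topology of the projective line: the closed sets are the finite sets and the
whole line. -/
instance : TopologicalSpace (P1 k) := TopologicalSpace.cofinite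

/-- Local sections of `𝒪(d)` at `p`: functions `h` of the homogeneous coordinates that are, on a
Zariski neighbourhood of `p`, a quotient `F / G` of homogeneous polynomials with
`deg F - deg G = d`, the denominator having no zero there. -/
def RegularOfDegreeAt (d : ℤ) (h : ∀ x : Fin 2 → k, x ≠ 0 → k) (p : P1 k) : Prop :=
  ∃ (m n : ℕ) (F G : MvPolynomial (Fin 2) k),
    F.IsHomogeneous m ∧ G.IsHomogeneous n ∧ (m : ℤ) - (n : ℤ) = d ∧
    ∀ᶠ q in 𝓝 p, ∀ (x : Fin 2 → k) (hx : x ≠ 0), mk x hx = q →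
      MvPolynomial.eval x G ≠ 0 ∧ h x hx = MvPolynomial.eval x F / MvPolynomial.eval x G

/-- `f` is a regular function at `p`: near `p` it is a quotient of homogeneous polynomials of the
same degree. -/
def RegularAt (f : P1 k → k) (p : P1 k) : Prop :=
  RegularOfDegreeAt 0 (fun x hx => f (mk x hx)) p

/-- `σ` is an automorphism of the variety `ℙ¹`: it and its inverse are continuous and pull back
regular functions to regular functions. -/
def IsAutomorphism (σ : P1 k ≃ P1 k) : Prop :=
  (Continuous σ ∧ ∀ (φ : P1 k → k) (p : P1 k), RegularAt φ (σ p) → RegularAt (φ ∘ σ) p) ∧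
  (Continuous σ.symm ∧
    ∀ (φ : P1 k → k) (p : P1 k), RegularAt φ (σ.symm p) → RegularAt (φ ∘ σ.symm) p)

theorem RegularOfDegreeAt.add {d : ℤ} {h h' : ∀ x : Fin 2 → k, x ≠ 0 → k} {p : P1 k}
    (H : RegularOfDegreeAt d h p) (H' : RegularOfDegreeAt d h' p) :
    RegularOfDegreeAt d (fun x hx => h x hx + h' x hx) p := by
  obtain ⟨m, n, F, G, hF, hG, hd, he⟩ := H
  obtain ⟨m', n', F', G', hF', hG', hd', he'⟩ := H'
  refine ⟨m + n', n + n', F * G' + G * F', G * G', ?_, hG.mul hG', by push_cast; omega, ?_⟩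
  · refine (hF.mul hG').add ?_
    have : m + n' = n + m' := by omega
    rw [this]
    exact hG.mul hF'
  · filter_upwards [he, he'] with q hq hq' x hx hxq
    obtain ⟨h1, h2⟩ := hq x hx hxq
    obtain ⟨h1', h2'⟩ := hq' x hx hxq
    refine ⟨by simpa using ⟨h1, h1'⟩, ?_⟩
    simp only [h2, h2', map_add, map_mul]
    field_simp

theorem RegularOfDegreeAt.mul {d d' : ℤ} {h h' : ∀ x : Fin 2 → k, x ≠ 0 → k} {p : P1 k}
    (H : RegularOfDegreeAt d h p) (H' : RegularOfDegreeAt d' h' p) :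
    RegularOfDegreeAt (d + d') (fun x hx => h x hx * h' x hx) p := by
  obtain ⟨m, n, F, G, hF, hG, hd, he⟩ := H
  obtain ⟨m', n', F', G', hF', hG', hd', he'⟩ := H'
  refine ⟨m + m', n + n', F * F', G * G', hF.mul hF', hG.mul hG', by push_cast; omega, ?_⟩
  filter_upwards [he, he'] with q hq hq' x hx hxq
  obtain ⟨h1, h2⟩ := hq x hx hxq
  obtain ⟨h1', h2'⟩ := hq' x hx hxq
  refine ⟨by simpa using ⟨h1, h1'⟩, ?_⟩
  simp only [h2, h2', map_mul]
  field_simp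

theorem regularAt_const (c : k) (p : P1 k) : RegularAt (fun _ => c) p :=
  ⟨0, 0, MvPolynomial.C c, MvPolynomial.C 1, MvPolynomial.isHomogeneous_C _ _,
    MvPolynomial.isHomogeneous_C _ _, by simp, Filter.Eventually.of_forall (by simp)⟩

end P1

/-- A tree of smooth rational curves over `k`: finitely many projective lines, glued along points
so that the dual graph is a tree. `param i` parametrizes the `i`-th irreducible component, and two
distinct components meet in at most one point. (Three components through one point would form a
triangle in the dual graph, so at most two components pass through each point.) The topology
and the regular functions, defined below, make each common point of two components an ordinary
node: its local ring consists of the pairs of germs on the two branches with the same value. -/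
structure RationalTree (k : Type u) [Field k] where
  /-- the closed points -/
  Pt : Type u
  /-- the index set of the irreducible components -/
  Comp : Type u
  [fintypeComp : Fintype Comp]
  param : Comp → P1 k → Pt
  param_injective : ∀ i, Function.Injective (param i)
  param_cover : ∀ p, ∃ i q, param i q = p
  inter_subsingleton : ∀ i j, i ≠ j →
    (Set.range (param i) ∩ Set.range (param j)).Subsingleton
  dualGraph_isTree : (SimpleGraph.fromRel fun i j =>
    (Set.range (param i) ∩ Set.range (param j)).Nonempty).IsTree

attribute [instance] RationalTree.fintypeComp

namespace RationalTree

variable {k : Type u} [Field k]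

/-- The Zariski topology: a set is open (closed) iff its trace on every component is. -/
instance (C : RationalTree k) : TopologicalSpace C.Pt :=
  ⨆ i, TopologicalSpace.coinduced (C.param i) inferInstance

/-- A function on `C` is regular at `p` if it is so along every component through `p`. -/
def RegularAt (C : RationalTree k) (f : C.Pt → k) (p : C.Pt) : Prop :=
  ∀ i q, C.param i q = p → P1.RegularAt (fun x => f (C.param i x)) q

/-- A node: a point lying on two distinct components. -/
def IsNode (C : RationalTree k) (p : C.Pt) : Prop :=
  ∃ i j, i ≠ j ∧ p ∈ Set.range (C.param i) ∧ p ∈ Set.range (C.param j)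

theorem RegularAt.add {C : RationalTree k} {f g : C.Pt → k} {p : C.Pt}
    (hf : C.RegularAt f p) (hg : C.RegularAt g p) : C.RegularAt (fun x => f x + g x) p :=
  fun i q h => (hf i q h).add (hg i q h)

theorem RegularAt.mul {C : RationalTree k} {f g : C.Pt → k} {p : C.Pt}
    (hf : C.RegularAt f p) (hg : C.RegularAt g p) : C.RegularAt (fun x => f x * g x) p :=
  fun i q h => (hf i q h).mul (hg i q h)

theorem regularAt_const (C : RationalTree k) (c : k) (p : C.Pt) : C.RegularAt (fun _ => c) p :=
  fun _ q _ => P1.regularAt_const c q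

/-- A morphism of varieties: a continuous map that pulls back regular functions to regular
functions. -/
structure Hom (C' C : RationalTree k) where
  toFun : C'.Pt → C.Pt
  continuous_toFun : Continuous toFun
  regular_comp : ∀ (φ : C.Pt → k) (p : C'.Pt),
    C.RegularAt φ (toFun p) → C'.RegularAt (fun x => φ (toFun x)) p

/-- An enlargement: a surjective morphism whose restriction to any irreducible component of `C'`
is constant or an isomorphism (onto a component of `C`). -/
def Hom.IsEnlargement {C' C : RationalTree k} (f : Hom C' C) : Prop :=
  Function.Surjective f.toFun ∧
  ∀ i' : C'.Comp,
    (∃ p, ∀ q, f.toFun (C'.param i' q) = p) ∨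
    (∃ (i : C.Comp) (σ : P1 k ≃ P1 k), P1.IsAutomorphism σ ∧
      ∀ q, f.toFun (C'.param i' q) = C.param i (σ q))

/-- `C'` arises from `C` by inserting projective lines at nodes: each fibre of `f` is a single
point, except that the fibre over a node may be a single irreducible component of `C'`. -/
def Hom.InsertsLinesAtNodes {C' C : RationalTree k} (f : Hom C' C) : Prop :=
  ∀ p : C.Pt, (∃! p', f.toFun p' = p) ∨
    (C.IsNode p ∧ ∃ i' : C'.Comp, f.toFun ⁻¹' {p} = Set.range (C'.param i'))

/-- A vector bundle of rank `r` on `C`: a family of vector spaces with a cover by open sets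
`base a` and trivializations over them, with regular transition matrices. (`chart a` is written as
a total family; only its values over `base a` matter.) -/
structure VectorBundle (C : RationalTree k) (r : ℕ) where
  fib : C.Pt → Type u
  [addCommGroup : ∀ p, AddCommGroup (fib p)]
  [module : ∀ p, Module k (fib p)]
  Idx : Type u
  base : Idx → Set C.Pt
  isOpen_base : ∀ a, IsOpen (base a)
  base_cover : ∀ p, ∃ a, p ∈ base a
  chart : Idx → ∀ p, fib p ≃ₗ[k] (Fin r → k)
  regular_transition : ∀ a b p, p ∈ base a → p ∈ base b → ∀ i j,
    C.RegularAt (fun q => chart b q ((chart a q).symm (Pi.single i 1)) j) p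

attribute [instance] VectorBundle.addCommGroup VectorBundle.module

namespace VectorBundle

variable {C : RationalTree k} {r : ℕ}

/-- A (set-theoretic) section is regular at `p` if its coordinates in the trivializations around
`p` are regular at `p`. -/
def RegularSectionAt (E : VectorBundle C r) (s : ∀ p, E.fib p) (p : C.Pt) : Prop :=
  ∀ a, p ∈ E.base a → ∀ j, C.RegularAt (fun q => E.chart a q (s q) j) p

/-- The space `H⁰(C, E)` of global sections. -/
def H0 (E : VectorBundle C r) : Submodule k (∀ p, E.fib p) where
  carrier := {s | ∀ p, E.RegularSectionAt s p}
  zero_mem' p a _ j := by simpa using C.regularAt_const 0 p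
  add_mem' {s t} hs ht p a ha j := by
    simpa using (hs p a ha j).add (ht p a ha j)
  smul_mem' c s hs p a ha j := by
    simpa using (C.regularAt_const c p).mul (hs p a ha j)

/-- The tensor product `E ⊗ L` of a vector bundle with a line bundle. -/
noncomputable def twist (E : VectorBundle C r) (L : VectorBundle C 1) : VectorBundle C r where
  fib p := E.fib p ⊗[k] L.fib p
  Idx := E.Idx × L.Idx
  base a := E.base a.1 ∩ L.base a.2
  isOpen_base a := (E.isOpen_base a.1).inter (L.isOpen_base a.2)
  base_cover p := by
    obtain ⟨a, ha⟩ := E.base_cover p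
    obtain ⟨b, hb⟩ := L.base_cover p
    exact ⟨(a, b), ha, hb⟩
  chart a p :=
    (TensorProduct.congr (E.chart a.1 p)
      ((L.chart a.2 p).trans (LinearEquiv.funUnique (Fin 1) k k))).trans
      (TensorProduct.rid k (Fin r → k))
  regular_transition a b p ha hb i j := by
    have h1 := E.regular_transition a.1 b.1 p ha.1 hb.1 i j
    have h2 := L.regular_transition a.2 b.2 p ha.2 hb.2 0 0
    have hone : (AddEquiv.funUnique (Fin 1) k).symm 1 = Pi.single 0 1 := by
      funext x
      rw [Subsingleton.elim x 0]
      simp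
    convert h1.mul h2 using 2 with q
    simp [hone, mul_comm]

/-- The pullback `f^* E`. -/
def pullback {C' : RationalTree k} (f : Hom C' C) (E : VectorBundle C r) : VectorBundle C' r where
  fib p := E.fib (f.toFun p)
  Idx := E.Idx
  base a := f.toFun ⁻¹' E.base a
  isOpen_base a := (E.isOpen_base a).preimage f.continuous_toFun
  base_cover p := E.base_cover (f.toFun p)
  chart a p := E.chart a (f.toFun p)
  regular_transition a b p ha hb i j :=
    f.regular_comp _ p (E.regular_transition a b (f.toFun p) ha hb i j)

/-- The line bundle `L` has degree `d` on the `i`-th component, i.e. its restriction to that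
component is `𝒪(d)`: there is a nowhere zero global section `σ` of `L|_{ℙ¹} ⊗ 𝒪(-d)`, that is, a
choice of nonzero vectors in the fibres of `L`, depending on the homogeneous coordinates, that in
local trivializations of `L` is regular and homogeneous of degree `-d`. -/
def HasDegreeOn (L : VectorBundle C 1) (i : C.Comp) (d : ℤ) : Prop :=
  ∃ σ : ∀ (x : Fin 2 → k) (hx : x ≠ 0), L.fib (C.param i (P1.mk x hx)),
    (∀ x hx, σ x hx ≠ 0) ∧
    ∀ a q, C.param i q ∈ L.base a →
      P1.RegularOfDegreeAt (-d) (fun x hx => L.chart a (C.param i (P1.mk x hx)) (σ x hx) 0) q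

/-- The line bundle `L` has (total) degree `n`: the sum of its degrees on the components is `n`. -/
def HasDegree (L : VectorBundle C 1) (n : ℤ) : Prop :=
  ∃ d : C.Comp → ℤ, (∀ i, L.HasDegreeOn i (d i)) ∧ ∑ i, d i = n

/-- The family of linear maps `j` embeds `L` as a subbundle of `E`: it is a morphism of vector
bundles (it maps regular local sections to regular local sections) and is injective on every
fibre. -/
def IsSubbundle {s : ℕ} (L : VectorBundle C s) (E : VectorBundle C r)
    (j : ∀ p, L.fib p →ₗ[k] E.fib p) : Prop :=
  (∀ (t : ∀ p, L.fib p) (p : C.Pt), L.RegularSectionAt t p →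
    E.RegularSectionAt (fun q => j q (t q)) p) ∧
  ∀ p, Function.Injective (j p)

end VectorBundle

end RationalTree

/-!
A line subbundle of the pullback of `E` to the curve with a projective line inserted at every node
amounts to line subbundles of the restrictions of `E` to the components of `C`: along an inserted
line `E` is trivial, so that two lines in the fibre at the node are joined by a trivial line
subbundle if they agree, and by one of degree `-1` otherwise
(`RationalTree.Rooting.exists_lineOn_inr`, `RationalTree.VectorBundle.exists_isSubbundle_of_lineOn`).
So the task is to choose line subbundles along the components whose total degree is at least the
number of nodes at which they disagree.

Root the dual graph. For each component `i` let `Mᵢ` be the greatest value of `degree minus number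
of disagreements` that can be achieved on the branch of `i`, i.e. by `i` and its descendants; it
exists because the degrees of line subbundles along a component are bounded
(`RationalTree.VectorBundle.exists_degree_bound`). Twist `E` by a line bundle with multidegree
`dᵢ = ∑ M_c - Mᵢ`, the sum being over the children `c` of `i`, and without the term `Mᵢ` at the root.
Its total degree is zero, so there is a nonzero section `s`. Along every component where `s` does
not vanish identically it generates a line subbundle of degree at least `-dᵢ` plus the number of
nodes at which `s` vanishes (`RationalTree.VectorBundle.IsHomSection.exists_lineOn`). By induction
from the leaves, if `s` is not zero along `i`, then its branch achieves at least `Mᵢ` with that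
line subbundle at `i`, and even `Mᵢ + 1` if `s` vanishes at the node joining `i` to its parent: a child
at whose node `s` vanishes costs a disagreement, which the zero of `s` pays for, and at the other
nodes the line subbundles agree. By the choice of `Mᵢ`, it follows that `s` does not vanish at the
node above `i`, hence is not zero along the parent of `i`. So `s` is not zero along the root, where
the same count gives the value `0`. This is `exists_labelling`, where the induction removes a deepest
component instead of handling branches.

For the geometry along a component, sections are written in homogeneous coordinates, and everything
rests on two facts about binary forms: a form vanishing at a point is divisible by the linear form of
that point (`P1.exists_eq_lin_mul`), and a rational function of negative degree without poles is
zero (`P1.eventually_eq_zero_of_noPoleAt`).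
-/

/-! ### Binary forms and their zeros on the projective line -/

namespace P1

open MvPolynomial Filter

variable {k : Type u} [Field k]

theorem exists_mk (q : P1 k) : ∃ (x : Fin 2 → k) (hx : x ≠ 0), mk x hx = q := by
  induction q using Projectivization.ind with
  | h x hx => exact ⟨x, hx, rfl⟩

theorem mk_eq_mk_iff {x y : Fin 2 → k} (hx : x ≠ 0) (hy : y ≠ 0) :
    mk x hx = mk y hy ↔ ∃ c : k, c ≠ 0 ∧ x = c • y := by
  refine (Projectivization.mk_eq_mk_iff k x y hx hy).trans ⟨?_, ?_⟩
  · rintro ⟨c, rfl⟩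
    exact ⟨c, c.ne_zero, rfl⟩
  · rintro ⟨c, hc, rfl⟩
    exact ⟨Units.mk0 c hc, rfl⟩

theorem eventually_nhds_iff {p : P1 k} {P : P1 k → Prop} :
    (∀ᶠ q in 𝓝 p, P q) ↔ P p ∧ ∀ᶠ q in cofinite, P q := by
  rw [_root_.eventually_nhds_iff]
  constructor
  · rintro ⟨t, ht, hot, hp⟩
    exact ⟨ht p hp, (show (tᶜ).Finite from hot ⟨p, hp⟩).subset fun q hq hqt => hq (ht q hqt)⟩
  · rintro ⟨hp, h⟩
    exact ⟨{q | P q}, fun _ h => h, fun _ => h, hp⟩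

theorem isOpen_of_finite_compl {s : Set (P1 k)} (hs : sᶜ.Finite) : IsOpen s := fun _ => hs

theorem finite_compl_of_isOpen {s : Set (P1 k)} (hs : IsOpen s) (h : s.Nonempty) : sᶜ.Finite :=
  hs h

instance [Infinite k] : Infinite (P1 k) := by
  have hne : ∀ t : k, (![1, t] : Fin 2 → k) ≠ 0 := fun t h => by
    simpa using congrFun h 0
  refine Infinite.of_injective (fun t : k => mk ![1, t] (hne t)) fun s t h => ?_
  obtain ⟨c, -, hc⟩ := (mk_eq_mk_iff _ _).1 h
  have h0 := congrFun hc 0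
  have h1 := congrFun hc 1
  simp at h0 h1
  rw [h1, ← h0, one_mul]

theorem eval_smul_of_isHomogeneous {m : ℕ} {F : MvPolynomial (Fin 2) k} (hF : F.IsHomogeneous m)
    (c : k) (x : Fin 2 → k) : eval (c • x) F = c ^ m * eval x F := by
  rw [eval_eq, eval_eq, Finset.mul_sum]
  refine Finset.sum_congr rfl fun d hd => ?_
  rw [hF.degree_eq_sum_deg_support hd]
  simp only [Pi.smul_apply, smul_eq_mul, mul_pow, Finset.prod_mul_distrib, Finset.prod_pow_eq_pow_sum]
  ring

theorem eval_eq_zero_iff_of_mk_eq {m : ℕ} {F : MvPolynomial (Fin 2) k} (hF : F.IsHomogeneous m)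
    {x y : Fin 2 → k} {hx : x ≠ 0} {hy : y ≠ 0} (h : mk x hx = mk y hy) :
    eval x F = 0 ↔ eval y F = 0 := by
  obtain ⟨c, hc, rfl⟩ := (mk_eq_mk_iff hx hy).1 h
  simp [eval_smul_of_isHomogeneous hF, hc]

/-- The linear form vanishing exactly at the point with homogeneous coordinates `a`. -/
noncomputable def lin (a : Fin 2 → k) : MvPolynomial (Fin 2) k := C (a 1) * X 0 - C (a 0) * X 1

theorem lin_isHomogeneous (a : Fin 2 → k) : (lin a).IsHomogeneous 1 :=
  (isHomogeneous_C_mul_X _ _).sub (isHomogeneous_C_mul_X _ _)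

theorem eval_lin (a x : Fin 2 → k) : eval x (lin a) = a 1 * x 0 - a 0 * x 1 := by simp [lin]

theorem eval_lin_eq_zero_iff {a x : Fin 2 → k} (ha : a ≠ 0) (hx : x ≠ 0) :
    eval x (lin a) = 0 ↔ mk x hx = mk a ha := by
  rw [mk_eq_mk_iff, eval_lin]
  constructor
  · intro h
    by_cases h0 : a 0 = 0
    · have h1 : a 1 ≠ 0 := fun h1 => ha (by ext i; fin_cases i <;> simp [h0, h1])
      have hx0 : x 0 = 0 := by simpa [h0, h1] using h
      have hx1 : x 1 ≠ 0 := fun h1 => hx (by ext i; fin_cases i <;> simp [hx0, h1])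
      refine ⟨x 1 / a 1, div_ne_zero hx1 h1, ?_⟩
      ext i; fin_cases i <;> simp [h0, hx0, h1]
    · have hx0 : x 0 ≠ 0 := fun hx0 => hx (by
        have : x 1 = 0 := by simpa [h0, hx0] using h
        ext i; fin_cases i <;> simp [hx0, this])
      refine ⟨x 0 / a 0, div_ne_zero hx0 h0, ?_⟩
      ext i; fin_cases i
      · simp [h0]
      · simp only [Fin.mk_one, Pi.smul_apply, smul_eq_mul]
        field_simp
        linear_combination -h
  · rintro ⟨c, -, rfl⟩
    simp only [Pi.smul_apply, smul_eq_mul]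
    ring

theorem lin_ne_zero {a : Fin 2 → k} (ha : a ≠ 0) : lin a ≠ 0 := by
  intro h
  refine ha (funext fun i => ?_)
  have h0 : eval ![1, 0] (lin a) = 0 := by rw [h, map_zero]
  have h1 : eval ![0, 1] (lin a) = 0 := by rw [h, map_zero]
  rw [eval_lin] at h0 h1
  fin_cases i
  · simpa using h1
  · simpa using h0

/-- A binary form vanishing at a point is divisible by the linear form of that point. -/
theorem exists_eq_lin_mul {m : ℕ} {F : MvPolynomial (Fin 2) k} (hF : F.IsHomogeneous (m + 1))
    {a : Fin 2 → k} (ha : a ≠ 0) (h : eval a F = 0) :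
    ∃ F' : MvPolynomial (Fin 2) k, F'.IsHomogeneous m ∧ F = lin a * F' := by
  obtain ⟨F₁, hF₁⟩ : lin a ∣ F := by
    -- Modulo the linear form, `aᵢ Xⱼ = aⱼ Xᵢ`, so that `aᵢ ^ (m + 1) F = F(a) Xᵢ ^ (m + 1) = 0`.
    obtain ⟨i, hi⟩ : ∃ i, a i ≠ 0 := by
      by_contra! hcon
      exact ha (funext hcon)
    set π := Ideal.Quotient.mk (Ideal.span {lin a})
    have hπ : π (C (a 1) * X 0) = π (C (a 0) * X 1) :=
      Ideal.Quotient.eq.2 (Ideal.mem_span_singleton_self _)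
    have hj : ∀ j, π (C (a i) * X j) = π (C (a j) * X i) := by
      intro j
      fin_cases i <;> fin_cases j <;> first | rfl | exact hπ | exact hπ.symm
    have key : π (C (a i ^ (m + 1)) * F) = π (C (eval a F) * X i ^ (m + 1)) := by
      rw [F.as_sum, map_sum, Finset.mul_sum, map_sum, map_sum, Finset.sum_mul, map_sum]
      refine Finset.sum_congr rfl fun d hd => ?_
      have hdeg : d.degree = m + 1 := (hF.degree_eq_sum_deg_support hd).symm
      rw [Finsupp.degree_eq_sum, Fin.sum_univ_two] at hdeg
      rw [eval_monomial, monomial_eq, Finsupp.prod_fintype _ _ (by simp),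
        Finsupp.prod_fintype _ _ (by simp), Fin.prod_univ_two, Fin.prod_univ_two, ← hdeg]
      have e0 := congrArg (· ^ d 0) (hj 0)
      have e1 := congrArg (· ^ d 1) (hj 1)
      simp only [map_mul, map_pow, mul_pow, pow_add] at e0 e1 ⊢
      linear_combination π (C (coeff d F)) * (π (C (a i)) ^ d 1 * π (X 1) ^ d 1) * e0 +
        π (C (coeff d F)) * (π (C (a 0)) ^ d 0 * π (X i) ^ d 0) * e1
    rw [h, C_0, zero_mul, map_zero, Ideal.Quotient.eq_zero_iff_mem, Ideal.mem_span_singleton] at key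
    obtain ⟨g, hg⟩ := key
    refine ⟨C ((a i ^ (m + 1))⁻¹) * g, ?_⟩
    rw [mul_left_comm, ← hg, ← mul_assoc, ← C_mul, inv_mul_cancel₀ (pow_ne_zero _ hi), C_1,
      one_mul]
  refine ⟨homogeneousComponent m F₁, homogeneousComponent_isHomogeneous _ _, ?_⟩
  conv_lhs => rw [← (homogeneousComponent_eq_self hF), hF₁, ← sum_homogeneousComponent F₁]
  rw [Finset.mul_sum, map_sum]
  have hterm : ∀ n, homogeneousComponent (m + 1) (lin a * homogeneousComponent n F₁) =
      if n = m then lin a * homogeneousComponent m F₁ else 0 := by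
    intro n
    rw [homogeneousComponent_of_mem ((mem_homogeneousSubmodule _ _).2
      ((lin_isHomogeneous a).mul (homogeneousComponent_isHomogeneous n F₁)))]
    by_cases hn : n = m
    · subst hn; simp [add_comm]
    · rw [if_neg (by omega), if_neg hn]
  simp only [hterm]
  rw [Finset.sum_ite_eq' (Finset.range (F₁.totalDegree + 1)) m]
  split_ifs with hm
  · rfl
  · rw [homogeneousComponent_eq_zero, mul_zero]
    rw [Finset.mem_range] at hm
    omega

theorem eventually_eval_ne_zero {m : ℕ} {F : MvPolynomial (Fin 2) k} (hF : F.IsHomogeneous m)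
    (h0 : F ≠ 0) : ∀ᶠ q in cofinite, ∀ x hx, mk x hx = q → eval x F ≠ 0 := by
  induction m generalizing F with
  | zero =>
    obtain ⟨c, rfl⟩ : ∃ c, F = C c :=
      ⟨_, totalDegree_eq_zero_iff_eq_C.1 ((totalDegree_zero_iff_isHomogeneous _).2 hF)⟩
    exact Eventually.of_forall fun q x hx _ => by
      rw [eval_C]; rintro rfl; exact h0 C_0
  | succ m ih =>
    by_cases hz : ∃ a, a ≠ 0 ∧ eval a F = 0
    · obtain ⟨a, ha, haF⟩ := hz
      obtain ⟨F', hF', rfl⟩ := exists_eq_lin_mul hF ha haF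
      have hne : ∀ᶠ q in cofinite, q ≠ mk a ha := by
        simp
      filter_upwards [ih hF' (right_ne_zero_of_mul h0), hne] with q hq hqa x hx hxq
      rw [map_mul]
      refine mul_ne_zero (fun h => hqa ?_) (hq x hx hxq)
      rw [← hxq, ← eval_lin_eq_zero_iff ha hx, h]
    · push Not at hz
      exact Eventually.of_forall fun q x hx _ => hz x hx

theorem eq_zero_of_eventually_eval_eq_zero [Infinite k] {m : ℕ} {F : MvPolynomial (Fin 2) k}
    (hF : F.IsHomogeneous m) (h : ∀ᶠ q in cofinite, ∀ x hx, mk x hx = q → eval x F = 0) :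
    F = 0 := by
  by_contra h0
  obtain ⟨q, h1, h2⟩ := (h.and (eventually_eval_ne_zero hF h0)).exists
  obtain ⟨x, hx, hxq⟩ := exists_mk q
  exact h2 x hx hxq (h1 x hx hxq)

/-! ### Regular functions of a given degree -/

theorem RegularOfDegreeAt.congr {d : ℤ} {h h' : ∀ x : Fin 2 → k, x ≠ 0 → k} {p : P1 k}
    (H : RegularOfDegreeAt d h p)
    (he : ∀ᶠ q in 𝓝 p, ∀ x hx, mk x hx = q → h' x hx = h x hx) : RegularOfDegreeAt d h' p := by
  obtain ⟨m, n, F, G, hF, hG, hd, hev⟩ := H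
  refine ⟨m, n, F, G, hF, hG, hd, ?_⟩
  filter_upwards [hev, he] with q hq hq' x hx hxq
  exact ⟨(hq x hx hxq).1, (hq' x hx hxq).trans (hq x hx hxq).2⟩

theorem regularOfDegreeAt_eval {m : ℕ} {F : MvPolynomial (Fin 2) k} (hF : F.IsHomogeneous m)
    (p : P1 k) : RegularOfDegreeAt m (fun x _ => eval x F) p :=
  ⟨m, 0, F, 1, hF, isHomogeneous_one _ _, by simp, Eventually.of_forall (by simp)⟩

theorem regularOfDegreeAt_zero (d : ℤ) (p : P1 k) :
    RegularOfDegreeAt d (fun _ _ => (0 : k)) p := by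
  obtain ⟨x, hx, rfl⟩ := exists_mk p
  obtain ⟨i, hi⟩ := Function.ne_iff.1 hx
  have hX := isHomogeneous_X_pow (R := k) i (-d).toNat
  have h0 : (X i ^ (-d).toNat : MvPolynomial (Fin 2) k) ≠ 0 := pow_ne_zero _ (X_ne_zero i)
  refine ⟨d.toNat, (-d).toNat, 0, _, isHomogeneous_zero _ _ _, hX, by omega, ?_⟩
  refine eventually_nhds_iff.2 ⟨fun y hy hyx => ⟨?_, by simp⟩, ?_⟩
  · rw [Ne, eval_eq_zero_iff_of_mk_eq hX hyx]
    simpa using fun h => absurd h hi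
  · filter_upwards [eventually_eval_ne_zero hX h0] with q hq y hy hyq
    exact ⟨hq y hy hyq, by simp⟩

theorem RegularOfDegreeAt.apply_smul {d : ℤ} {h : ∀ x : Fin 2 → k, x ≠ 0 → k} {x : Fin 2 → k}
    {hx : x ≠ 0} (H : RegularOfDegreeAt d h (mk x hx)) {c : k} (hc : c ≠ 0) (hcx : c • x ≠ 0) :
    h (c • x) hcx = c ^ d * h x hx := by
  obtain ⟨m, n, F, G, hF, hG, rfl, hev⟩ := H
  have hq := hev.self_of_nhds
  have e : mk (c • x) hcx = mk x hx := (mk_eq_mk_iff _ _).2 ⟨c, hc, rfl⟩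
  rw [(hq x hx rfl).2, (hq _ hcx e).2, eval_smul_of_isHomogeneous hF,
    eval_smul_of_isHomogeneous hG, zpow_sub₀ hc, zpow_natCast, zpow_natCast]
  field_simp

/-- A regular function of some degree that does not vanish at `p` does not vanish near `p`, and
its inverse is regular of the opposite degree. -/
theorem RegularOfDegreeAt.inv {d : ℤ} {h : ∀ x : Fin 2 → k, x ≠ 0 → k} {x : Fin 2 → k}
    {hx : x ≠ 0} (H : RegularOfDegreeAt d h (mk x hx)) (h0 : h x hx ≠ 0) :
    RegularOfDegreeAt (-d) (fun y hy => (h y hy)⁻¹) (mk x hx) ∧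
      ∀ᶠ q in 𝓝 (mk x hx), ∀ y hy, mk y hy = q → h y hy ≠ 0 := by
  obtain ⟨m, n, F, G, hF, hG, rfl, hev⟩ := H
  have hq := hev.self_of_nhds x hx rfl
  have hFx : eval x F ≠ 0 := fun hz => h0 (by rw [hq.2, hz, zero_div])
  have hFev : ∀ᶠ q in 𝓝 (mk x hx), ∀ y hy, mk y hy = q → eval y F ≠ 0 := by
    refine eventually_nhds_iff.2 ⟨fun y hy hyx => ?_, eventually_eval_ne_zero hF ?_⟩
    · rwa [Ne, eval_eq_zero_iff_of_mk_eq hF hyx]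
    · rintro rfl
      exact hFx (map_zero _)
  refine ⟨⟨n, m, G, F, hG, hF, by ring, ?_⟩, ?_⟩
  · filter_upwards [hev, hFev] with q hq hFq y hy hyq
    exact ⟨hFq y hy hyq, by rw [(hq y hy hyq).2, inv_div]⟩
  · filter_upwards [hev, hFev] with q hq hFq y hy hyq
    rw [(hq y hy hyq).2]
    exact div_ne_zero (hFq y hy hyq) (hq y hy hyq).1

theorem RegularOfDegreeAt.sum {ι : Type*} (s : Finset ι) {d : ℤ}
    {h : ι → ∀ x : Fin 2 → k, x ≠ 0 → k} {p : P1 k}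
    (H : ∀ i ∈ s, RegularOfDegreeAt d (h i) p) :
    RegularOfDegreeAt d (fun x hx => ∑ i ∈ s, h i x hx) p := by
  classical
  induction s using Finset.induction_on with
  | empty => simpa using regularOfDegreeAt_zero d p
  | insert i s hi ih =>
    simp only [Finset.sum_insert hi]
    exact (H i (Finset.mem_insert_self _ _)).add
      (ih fun j hj => H j (Finset.mem_insert_of_mem hj))

theorem RegularOfDegreeAt.pow {d : ℤ} {h : ∀ x : Fin 2 → k, x ≠ 0 → k} {p : P1 k}
    (H : RegularOfDegreeAt d h p) (n : ℕ) :
    RegularOfDegreeAt (n * d) (fun x hx => h x hx ^ n) p := by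
  induction n with
  | zero => simpa [RegularAt] using regularAt_const (1 : k) p
  | succ n ih => simpa [pow_succ, add_mul] using ih.mul H

theorem RegularOfDegreeAt.zpow {d : ℤ} {h : ∀ x : Fin 2 → k, x ≠ 0 → k} {x : Fin 2 → k}
    {hx : x ≠ 0} (H : RegularOfDegreeAt d h (mk x hx)) (h0 : h x hx ≠ 0) (n : ℤ) :
    RegularOfDegreeAt (n * d) (fun y hy => h y hy ^ n) (mk x hx) := by
  cases n with
  | ofNat n => simpa using H.pow n
  | negSucc n =>
    have := (H.inv h0).1.pow (n + 1)
    have e : ((n + 1 : ℕ) : ℤ) * -d = Int.negSucc n * d := by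
      rw [Int.negSucc_eq]
      push_cast
      ring
    rw [e] at this
    simpa only [zpow_negSucc, inv_pow] using this

/-- A regular function vanishing at a point is locally a multiple of the linear form of that
point. -/
theorem RegularOfDegreeAt.exists_eq_lin_mul {d : ℤ} {h : ∀ x : Fin 2 → k, x ≠ 0 → k}
    {a : Fin 2 → k} {ha : a ≠ 0} (H : RegularOfDegreeAt d h (mk a ha)) (h0 : h a ha = 0) :
    ∃ h' : ∀ x : Fin 2 → k, x ≠ 0 → k, RegularOfDegreeAt (d - 1) h' (mk a ha) ∧
      ∀ᶠ q in 𝓝 (mk a ha), ∀ x hx, mk x hx = q → h x hx = eval x (lin a) * h' x hx := by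
  obtain ⟨m, n, F, G, hF, hG, rfl, hev⟩ := H
  have hFa : eval a F = 0 := by
    have := hev.self_of_nhds a ha rfl
    rw [this.2, div_eq_zero_iff] at h0
    exact h0.resolve_right this.1
  cases m with
  | zero =>
    obtain ⟨c, rfl⟩ : ∃ c, F = C c :=
      ⟨_, totalDegree_eq_zero_iff_eq_C.1 ((totalDegree_zero_iff_isHomogeneous _).2 hF)⟩
    rw [eval_C] at hFa
    refine ⟨fun _ _ => 0, regularOfDegreeAt_zero _ _, ?_⟩
    filter_upwards [hev] with q hq x hx hxq
    rw [(hq x hx hxq).2, eval_C, hFa, zero_div, mul_zero]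
  | succ m =>
    obtain ⟨F', hF', rfl⟩ := P1.exists_eq_lin_mul hF ha hFa
    refine ⟨fun x _ => eval x F' / eval x G, ⟨m, n, F', G, hF', hG, by push_cast; ring, ?_⟩, ?_⟩
    · filter_upwards [hev] with q hq x hx hxq
      exact ⟨(hq x hx hxq).1, rfl⟩
    · filter_upwards [hev] with q hq x hx hxq
      rw [(hq x hx hxq).2, map_mul, mul_div_assoc]

/-! ### Rational functions without poles -/

theorem exists_eval_eq_zero [IsAlgClosed k] {n : ℕ} {G : MvPolynomial (Fin 2) k}
    (hG : G.IsHomogeneous (n + 1)) : ∃ a, a ≠ 0 ∧ eval a G = 0 := by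
  by_contra! hcon
  have : Infinite k := IsAlgClosed.instInfinite
  set g : Polynomial k := aeval ![Polynomial.X, 1] G with hg
  have hgt : ∀ t, g.eval t = eval ![t, 1] G := by
    intro t
    have : (Polynomial.aeval t).comp (aeval ![Polynomial.X, 1]) =
        (aeval ![t, 1] : MvPolynomial (Fin 2) k →ₐ[k] k) := by
      ext i
      fin_cases i <;> simp
    have := DFunLike.congr_fun this G
    simpa [hg, Polynomial.coe_aeval_eq_eval, aeval_eq_eval] using this
  have hdeg : g.degree = 0 := by
    by_contra hd
    obtain ⟨t, ht⟩ := IsAlgClosed.exists_root g hd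
    refine hcon ![t, 1] (fun h => by simpa using congrFun h 1) ?_
    rw [← hgt]
    exact ht
  rw [Polynomial.eq_C_of_degree_eq_zero hdeg] at hgt
  simp only [Polynomial.eval_C] at hgt
  set c := g.coeff 0
  -- The form is constant on the line `X 1 = 1`, hence it is a multiple of a power of `X 1`.
  have hzero : G - C c * X 1 ^ (n + 1) = 0 := by
    refine eq_zero_of_eventually_eval_eq_zero
      (hG.sub (isHomogeneous_C_mul_X_pow c 1 (n + 1))) ?_
    filter_upwards [eventually_eval_ne_zero (isHomogeneous_X k (1 : Fin 2)) (X_ne_zero _)]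
      with q hq x hx hxq
    have hx1 : x 1 ≠ 0 := by simpa using hq x hx hxq
    have hxe : x = x 1 • ![x 0 / x 1, 1] := by
      ext i
      fin_cases i
      · simp [mul_div_cancel₀ _ hx1]
      · simp
    rw [map_sub, sub_eq_zero]
    conv_lhs => rw [hxe, eval_smul_of_isHomogeneous hG, ← hgt]
    simp [mul_comm]
  refine hcon ![1, 0] (fun h => by simpa using congrFun h 0) ?_
  rw [sub_eq_zero.1 hzero]
  simp

/-- `h` has no pole at `p`: away from finitely many points, it agrees with a function that is
regular of degree `d` at `p`. -/
def NoPoleAt (d : ℤ) (h : ∀ x : Fin 2 → k, x ≠ 0 → k) (p : P1 k) : Prop :=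
  ∃ h' : ∀ x : Fin 2 → k, x ≠ 0 → k, RegularOfDegreeAt d h' p ∧
    ∀ᶠ q in cofinite, ∀ x hx, mk x hx = q → h x hx = h' x hx

/-- A rational function of negative degree without poles vanishes: if its denominator has minimal
degree then it has no zero, since the numerator would vanish there as well. -/
theorem eventually_eq_zero_of_noPoleAt [IsAlgClosed k] {d : ℤ} (hd : d < 0)
    {h : ∀ x : Fin 2 → k, x ≠ 0 → k} (H : ∀ p, NoPoleAt d h p) :
    ∀ᶠ q in cofinite, ∀ x hx, mk x hx = q → h x hx = 0 := by
  have : Infinite k := IsAlgClosed.instInfinite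
  have hrat : ∀ p : P1 k, ∃ (m n : ℕ) (F G : MvPolynomial (Fin 2) k), F.IsHomogeneous m ∧
      G.IsHomogeneous n ∧ (m : ℤ) - n = d ∧ (∀ x hx, mk x hx = p → eval x G ≠ 0) ∧
      ∀ᶠ q in cofinite, ∀ x hx, mk x hx = q → h x hx = eval x F / eval x G := by
    intro p
    obtain ⟨h', ⟨m, n, F, G, hF, hG, he, hev⟩, hh'⟩ := H p
    rw [eventually_nhds_iff] at hev
    refine ⟨m, n, F, G, hF, hG, he, fun x hx hxp => (hev.1 x hx hxp).1, ?_⟩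
    filter_upwards [hev.2, hh'] with q hq hq' x hx hxq
    rw [hq' x hx hxq, (hq x hx hxq).2]
  have main : ∀ (n m : ℕ) (F G : MvPolynomial (Fin 2) k), F.IsHomogeneous m →
      G.IsHomogeneous n → (m : ℤ) - n = d → G ≠ 0 →
      (∀ᶠ q in cofinite, ∀ x hx, mk x hx = q → h x hx = eval x F / eval x G) →
      ∀ᶠ q in cofinite, ∀ x hx, mk x hx = q → h x hx = 0 := by
    intro n
    induction n with
    | zero => intro m _ _ _ _ he; omega
    | succ n ih =>
      intro m F G hF hG he hG0 hev
      obtain ⟨a, ha, haG⟩ := exists_eval_eq_zero hG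
      obtain ⟨m', n', F', G', hF', hG', he', hG'a, hev'⟩ := hrat (mk a ha)
      have hG'0 : G' ≠ 0 := by
        rintro rfl
        exact hG'a a ha rfl (map_zero _)
      have heq : F * G' - F' * G = 0 := by
        refine eq_zero_of_eventually_eval_eq_zero (m := m + n') ((hF.mul hG').sub ?_) ?_
        · have : m + n' = m' + (n + 1) := by omega
          rw [this]
          exact hF'.mul hG
        · filter_upwards [hev, hev', eventually_eval_ne_zero hG hG0,
            eventually_eval_ne_zero hG' hG'0] with q h1 h2 h3 h4 x hx hxq
          have := (h1 x hx hxq).symm.trans (h2 x hx hxq)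
          rw [div_eq_div_iff (h3 x hx hxq) (h4 x hx hxq)] at this
          rw [map_sub, map_mul, map_mul, this, sub_self]
      have haF : eval a F = 0 := by
        have := congrArg (eval a) heq
        rw [map_sub, map_mul, map_mul, haG, mul_zero, sub_zero, map_zero] at this
        exact (mul_eq_zero.1 this).resolve_right (hG'a a ha rfl)
      cases m with
      | zero =>
        obtain ⟨c, rfl⟩ : ∃ c, F = C c :=
          ⟨_, totalDegree_eq_zero_iff_eq_C.1 ((totalDegree_zero_iff_isHomogeneous _).2 hF)⟩
        rw [eval_C] at haF
        filter_upwards [hev] with q hq x hx hxq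
        rw [hq x hx hxq, eval_C, haF, zero_div]
      | succ m =>
        obtain ⟨F₁, hF₁, rfl⟩ := exists_eq_lin_mul hF ha haF
        obtain ⟨G₁, hG₁, rfl⟩ := exists_eq_lin_mul hG ha haG
        refine ih m F₁ G₁ hF₁ hG₁ (by push_cast at he; omega) (right_ne_zero_of_mul hG0) ?_
        filter_upwards [hev, eventually_eval_ne_zero (lin_isHomogeneous a) (lin_ne_zero ha)]
          with q hq hl x hx hxq
        rw [hq x hx hxq, map_mul, map_mul, mul_div_mul_left _ _ (hl x hx hxq)]
  obtain ⟨q⟩ : Nonempty (P1 k) := inferInstance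
  obtain ⟨m, n, F, G, hF, hG, he, hGq, hev⟩ := hrat q
  refine main n m F G hF hG he ?_ hev
  rintro rfl
  obtain ⟨x, hx, hxq⟩ := exists_mk q
  exact hGq x hx hxq (map_zero _)

/-- Finitely many rational functions of degree zero have a common denominator. -/
theorem exists_common_denominator {ι : Type*} [Fintype ι]
    (T : ι → ∀ x : Fin 2 → k, x ≠ 0 → k) (H : ∀ s, ∃ p, RegularOfDegreeAt 0 (T s) p) :
    ∃ (M : ℕ) (Q : MvPolynomial (Fin 2) k), Q.IsHomogeneous M ∧ Q ≠ 0 ∧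
      ∀ s, ∃ P : MvPolynomial (Fin 2) k, P.IsHomogeneous M ∧
        ∀ᶠ q in cofinite, ∀ x hx, mk x hx = q → eval x Q * T s x hx = eval x P := by
  classical
  have hrat : ∀ s, ∃ (n : ℕ) (F G : MvPolynomial (Fin 2) k), F.IsHomogeneous n ∧
      G.IsHomogeneous n ∧ G ≠ 0 ∧
      ∀ᶠ q in cofinite, ∀ x hx, mk x hx = q → eval x G * T s x hx = eval x F := by
    intro s
    obtain ⟨p, m, n, F, G, hF, hG, he, hev⟩ := H s
    obtain rfl : m = n := by omega
    rw [eventually_nhds_iff] at hev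
    refine ⟨m, F, G, hF, hG, ?_, ?_⟩
    · rintro rfl
      obtain ⟨x, hx, hxp⟩ := exists_mk p
      exact (hev.1 x hx hxp).1 (map_zero _)
    · filter_upwards [hev.2] with q hq x hx hxq
      rw [(hq x hx hxq).2, mul_div_cancel₀ _ (hq x hx hxq).1]
  choose n F G hF hG hG0 hev using hrat
  refine ⟨∑ s, n s, ∏ s, G s, IsHomogeneous.prod _ _ _ fun s _ => hG s,
    Finset.prod_ne_zero_iff.2 fun s _ => hG0 s, fun s => ?_⟩
  refine ⟨F s * ∏ t ∈ Finset.univ.erase s, G t, ?_, ?_⟩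
  · rw [← Finset.add_sum_erase _ n (Finset.mem_univ s)]
    exact (hF s).mul (IsHomogeneous.prod _ _ _ fun t _ => hG t)
  · filter_upwards [hev s] with q hq x hx hxq
    rw [← Finset.mul_prod_erase _ G (Finset.mem_univ s), map_mul, map_mul, ← hq x hx hxq]
    ring

end P1

/-! ### Homogeneous sections of a bundle along a component -/

namespace RationalTree

variable {k : Type u} [Field k] {C : RationalTree k}

theorem isOpen_iff {s : Set C.Pt} : IsOpen s ↔ ∀ i, IsOpen (C.param i ⁻¹' s) := by
  simp only [isOpen_iSup_iff, isOpen_coinduced]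

namespace VectorBundle

open Filter

variable {r : ℕ} {E : VectorBundle C r} {i : C.Comp}

/-- `σ` is a section of `E ⊗ 𝒪(d)` along the `i`-th component: a family of vectors in the fibres of
`E` depending on the homogeneous coordinates, homogeneous of degree `d` and regular in the
trivializations of `E`. -/
def IsHomSection (E : VectorBundle C r) (i : C.Comp) (d : ℤ)
    (σ : ∀ (x : Fin 2 → k) (hx : x ≠ 0), E.fib (C.param i (P1.mk x hx))) : Prop :=
  ∀ a q, C.param i q ∈ E.base a → ∀ j,
    P1.RegularOfDegreeAt d (fun x hx => E.chart a (C.param i (P1.mk x hx)) (σ x hx) j) q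

/-- The coordinates over `base b` in terms of those over `base a` and the transition matrix. -/
theorem chart_eq_sum (E : VectorBundle C r) (a b : E.Idx) (p : C.Pt) (v : E.fib p) (j : Fin r) :
    E.chart b p v j =
      ∑ l, E.chart b p ((E.chart a p).symm (Pi.single l 1)) j * E.chart a p v l := by
  conv_lhs => rw [← (E.chart a p).symm_apply_apply v, pi_eq_sum_univ' (E.chart a p v)]
  simp only [map_sum, map_smul, Finset.sum_apply, Pi.smul_apply, smul_eq_mul]
  refine Finset.sum_congr rfl fun l _ => ?_
  rw [mul_comm]

theorem eventually_mem_base {a : E.Idx} {q : P1 k} (ha : C.param i q ∈ E.base a) :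
    ∀ᶠ q' in 𝓝 q, C.param i q' ∈ E.base a :=
  (isOpen_iff.1 (E.isOpen_base a) i).mem_nhds ha

/-- Regularity of a homogeneous section at a point can be tested in a single trivialization. -/
theorem regularOfDegreeAt_chart_of_chart {d : ℤ}
    {σ : ∀ (x : Fin 2 → k) (hx : x ≠ 0), E.fib (C.param i (P1.mk x hx))} {a b : E.Idx} {q : P1 k}
    (ha : C.param i q ∈ E.base a) (hb : C.param i q ∈ E.base b)
    (H : ∀ j, P1.RegularOfDegreeAt d
      (fun x hx => E.chart a (C.param i (P1.mk x hx)) (σ x hx) j) q) (j : Fin r) :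
    P1.RegularOfDegreeAt d (fun x hx => E.chart b (C.param i (P1.mk x hx)) (σ x hx) j) q := by
  have h := P1.RegularOfDegreeAt.sum Finset.univ fun l _ =>
    (E.regular_transition a b _ ha hb l j i q rfl).mul (H l)
  rw [zero_add] at h
  exact h.congr (Eventually.of_forall fun _ x hx _ => E.chart_eq_sum a b _ _ _)

theorem IsHomSection.eq_zero_of_eventually [Infinite k] {d : ℤ}
    {σ : ∀ (x : Fin 2 → k) (hx : x ≠ 0), E.fib (C.param i (P1.mk x hx))}
    (hσ : E.IsHomSection i d σ)
    (h : ∀ᶠ q in cofinite, ∀ x hx, P1.mk x hx = q → σ x hx = 0) (x : Fin 2 → k) (hx : x ≠ 0) :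
    σ x hx = 0 := by
  obtain ⟨a, ha⟩ := E.base_cover (C.param i (P1.mk x hx))
  refine (E.chart a _).map_eq_zero_iff.1 (funext fun j => ?_)
  obtain ⟨m, n, F, G, hF, hG, -, hev⟩ := hσ a _ ha j
  rw [P1.eventually_nhds_iff] at hev
  have hF0 : F = 0 := by
    refine P1.eq_zero_of_eventually_eval_eq_zero hF ?_
    filter_upwards [h, hev.2] with q h1 h2 y hy hyq
    have := h2 y hy hyq
    rw [h1 y hy hyq, map_zero, Pi.zero_apply, eq_comm, div_eq_zero_iff] at this
    exact this.2.resolve_right this.1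
  refine (hev.1 x hx rfl).2.trans ?_
  rw [hF0, map_zero, zero_div, Pi.zero_apply]

/-- The twists `E ⊗ 𝒪(d)` have no sections along a component for `d` sufficiently negative: with a
common denominator for the transition functions from one trivialization to those at its finitely
many missing points, the coordinates of a section become rational functions without poles. -/
theorem exists_degree_bound [IsAlgClosed k] (E : VectorBundle C r) (i : C.Comp) :
    ∃ B : ℕ, ∀ (d : ℤ) (σ : ∀ (x : Fin 2 → k) (hx : x ≠ 0), E.fib (C.param i (P1.mk x hx))),
      E.IsHomSection i d σ → (∃ x hx, σ x hx ≠ 0) → 0 ≤ d + B := by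
  have : Infinite k := IsAlgClosed.instInfinite
  obtain ⟨q₀⟩ : Nonempty (P1 k) := inferInstance
  obtain ⟨a, ha⟩ := E.base_cover (C.param i q₀)
  have hfin : ∀ (b : E.Idx) (q : P1 k), C.param i q ∈ E.base b →
      {q | C.param i q ∉ E.base b}.Finite := fun b q hb =>
    P1.finite_compl_of_isOpen (isOpen_iff.1 (E.isOpen_base b) i) ⟨q, hb⟩
  have hZ := hfin a q₀ ha
  choose b hb using fun q => E.base_cover (C.param i q)
  have := hZ.fintype
  obtain ⟨M, Q, hQ, hQ0, hP⟩ := P1.exists_common_denominator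
    (fun (s : {q | C.param i q ∉ E.base a} × Fin r × Fin r) x hx =>
      E.chart a (C.param i (P1.mk x hx))
        ((E.chart (b s.1) (C.param i (P1.mk x hx))).symm (Pi.single s.2.1 1)) s.2.2) (by
      rintro ⟨⟨z, hz⟩, l, j⟩
      obtain ⟨q, hq⟩ := (hZ.union (hfin (b z) z (hb z))).infinite_compl.nonempty
      simp only [Set.mem_compl_iff, Set.mem_union, Set.mem_ofPred_eq, not_or, not_not] at hq
      exact ⟨q, E.regular_transition (b z) a _ hq.2 hq.1 l j i q rfl⟩)
  refine ⟨M, fun d σ hσ hne => ?_⟩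
  by_contra! hneg
  have hpole : ∀ j q, P1.NoPoleAt (d + M)
      (fun x hx => MvPolynomial.eval x Q * E.chart a (C.param i (P1.mk x hx)) (σ x hx) j) q := by
    intro j q
    by_cases hq : C.param i q ∈ E.base a
    · refine ⟨_, ?_, Eventually.of_forall fun _ _ _ _ => rfl⟩
      rw [add_comm]
      exact (P1.regularOfDegreeAt_eval hQ q).mul (hσ a q hq j)
    · choose P hPh hPe using fun l => hP (⟨q, hq⟩, l, j)
      refine ⟨_, P1.RegularOfDegreeAt.sum Finset.univ (h := fun l x hx =>
          E.chart (b q) (C.param i (P1.mk x hx)) (σ x hx) l * MvPolynomial.eval x (P l))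
        fun l _ => ?_, ?_⟩
      · exact (hσ (b q) q (hb q) l).mul (P1.regularOfDegreeAt_eval (hPh l) q)
      · filter_upwards [eventually_all.2 hPe] with q' hq' x hx hxq
        rw [E.chart_eq_sum (b q) a, Finset.mul_sum]
        refine Finset.sum_congr rfl fun l _ => ?_
        rw [← hq' l x hx hxq]
        ring
  obtain ⟨x, hx, hxne⟩ := hne
  refine hxne (hσ.eq_zero_of_eventually ?_ x hx)
  filter_upwards [eventually_all.2 fun j => P1.eventually_eq_zero_of_noPoleAt hneg (hpole j),
    P1.eventually_eval_ne_zero hQ hQ0] with q h1 h2 y hy hyq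
  refine (E.chart a _).map_eq_zero_iff.1 (funext fun j => ?_)
  exact (mul_eq_zero.1 (h1 j y hy hyq)).resolve_left (h2 y hy hyq)

/-- A homogeneous section vanishing at a point is divisible by the linear form of that point. -/
theorem IsHomSection.exists_eq_lin_smul {d : ℤ}
    {σ : ∀ (x : Fin 2 → k) (hx : x ≠ 0), E.fib (C.param i (P1.mk x hx))}
    (hσ : E.IsHomSection i d σ) {y : Fin 2 → k} {hy : y ≠ 0} (h0 : σ y hy = 0) :
    ∃ τ : ∀ (x : Fin 2 → k) (hx : x ≠ 0), E.fib (C.param i (P1.mk x hx)),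
      E.IsHomSection i (d - 1) τ ∧
      ∀ x hx, σ x hx = MvPolynomial.eval x (P1.lin y) • τ x hx := by
  classical
  obtain ⟨a, ha⟩ := E.base_cover (C.param i (P1.mk y hy))
  choose h' hh' hev using fun j => (hσ a _ ha j).exists_eq_lin_mul (by rw [h0]; simp)
  let τ : ∀ (x : Fin 2 → k) (hx : x ≠ 0), E.fib (C.param i (P1.mk x hx)) := fun x hx =>
    if P1.mk x hx = P1.mk y hy then (E.chart a _).symm fun j => h' j x hx
    else (MvPolynomial.eval x (P1.lin y))⁻¹ • σ x hx
  have hlin : ∀ x hx, P1.mk x hx ≠ P1.mk y hy → MvPolynomial.eval x (P1.lin y) ≠ 0 :=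
    fun x hx hne h => hne ((P1.eval_lin_eq_zero_iff hy hx).1 h)
  have hστ : ∀ x hx, σ x hx = MvPolynomial.eval x (P1.lin y) • τ x hx := by
    intro x hx
    by_cases hxy : P1.mk x hx = P1.mk y hy
    · refine (E.chart a _).injective (funext fun j => ?_)
      rw [(hev j).self_of_nhds x hx hxy]
      simp [τ, hxy]
    · simp [τ, hxy, smul_smul, mul_inv_cancel₀ (hlin x hx hxy)]
  refine ⟨τ, fun b q hb j => ?_, hστ⟩
  by_cases hq : q = P1.mk y hy
  · subst hq
    refine regularOfDegreeAt_chart_of_chart ha hb (fun l => (hh' l).congr ?_) j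
    filter_upwards [hev l] with q hq x hx hxq
    by_cases hxy : P1.mk x hx = P1.mk y hy
    · simp [τ, hxy]
    · refine mul_left_cancel₀ (hlin x hx hxy) ?_
      rw [← hq x hx hxq, hστ x hx, map_smul, Pi.smul_apply, smul_eq_mul]
  · obtain ⟨z, hz, rfl⟩ := P1.exists_mk q
    have hinv := ((P1.regularOfDegreeAt_eval (P1.lin_isHomogeneous y) (P1.mk z hz)).inv
      (hlin z hz hq)).1
    have hmul := hinv.mul (hσ b _ hb j)
    rw [show -((1 : ℕ) : ℤ) + d = d - 1 by push_cast; ring] at hmul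
    refine hmul.congr (P1.eventually_nhds_iff.2 ⟨fun x hx hxz => ?_, ?_⟩)
    · simp [τ, hxz, hq]
    · have : ∀ᶠ q in cofinite, q ≠ P1.mk y hy := by simp
      filter_upwards [this] with q hq x hx hxq
      simp [τ, hxq, hq]

/-- A line subbundle, of degree `deg`, of the restriction of `E` to the `i`-th component: a nowhere
zero section of its twist by `𝒪(-deg)`. -/
structure LineOn (E : VectorBundle C r) (i : C.Comp) where
  deg : ℤ
  sec : ∀ (x : Fin 2 → k) (hx : x ≠ 0), E.fib (C.param i (P1.mk x hx))
  isHomSection : E.IsHomSection i (-deg) sec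
  sec_ne_zero : ∀ x hx, sec x hx ≠ 0

/-- A nonzero section of `E ⊗ 𝒪(d)` along a component generates a line subbundle of degree at
least `-d` plus the number of its zeros. -/
theorem IsHomSection.exists_lineOn [IsAlgClosed k] {d : ℤ}
    {σ : ∀ (x : Fin 2 → k) (hx : x ≠ 0), E.fib (C.param i (P1.mk x hx))}
    (hσ : E.IsHomSection i d σ) (hne : ∃ x hx, σ x hx ≠ 0) (Z : Finset (P1 k))
    (hZ : ∀ x hx, P1.mk x hx ∈ Z → σ x hx = 0) :
    ∃ l : E.LineOn i, -d + Z.card ≤ l.deg ∧ ∀ x hx, ∃ c : k, σ x hx = c • l.sec x hx := by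
  classical
  obtain ⟨B, hB⟩ := E.exists_degree_bound i
  have h0 := hB d σ hσ hne
  obtain ⟨N, hN⟩ : ∃ N : ℕ, (N : ℤ) = d + B := ⟨(d + B).toNat, by omega⟩
  induction N using Nat.strong_induction_on generalizing d σ Z with
  | _ N ih =>
    by_cases hz : ∃ y hy, σ y hy = 0
    · obtain ⟨y, hy, hy0⟩ := hz
      obtain ⟨τ, hτ, hστ⟩ := hσ.exists_eq_lin_smul hy0
      have hτne : ∃ x hx, τ x hx ≠ 0 := by
        obtain ⟨x, hx, hxne⟩ := hne
        exact ⟨x, hx, fun h => hxne (by rw [hστ, h, smul_zero])⟩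
      have hτ0 := hB _ τ hτ hτne
      obtain ⟨l, hl, hlτ⟩ := ih (N - 1) (by omega) hτ hτne (Z.erase (P1.mk y hy)) (by
        intro x hx hxZ
        obtain ⟨hxy, hxZ⟩ := Finset.mem_erase.1 hxZ
        have := hZ x hx hxZ
        rw [hστ, smul_eq_zero, P1.eval_lin_eq_zero_iff hy hx] at this
        exact this.resolve_left hxy) hτ0 (by omega)
      refine ⟨l, ?_, fun x hx => ?_⟩
      · have := Finset.pred_card_le_card_erase (s := Z) (a := P1.mk y hy)
        omega
      · obtain ⟨c, hc⟩ := hlτ x hx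
        exact ⟨MvPolynomial.eval x (P1.lin y) * c, by rw [hστ, hc, smul_smul]⟩
    · push Not at hz
      have hZ0 : Z = ∅ := by
        refine Finset.eq_empty_of_forall_notMem fun q hq => ?_
        obtain ⟨x, hx, rfl⟩ := P1.exists_mk q
        exact hz x hx (hZ x hx hq)
      exact ⟨⟨-d, σ, by rwa [neg_neg], hz⟩, by simp [hZ0], fun x hx => ⟨1, (one_smul _ _).symm⟩⟩

end VectorBundle

end RationalTree

/-! ### Rooted trees -/

/-- `par` and `depth` describe `G` as a tree with root `r`: its edges join each `i ≠ r` with its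
parent `par i`, which has smaller depth. (The value `par r` is irrelevant.) -/
structure SimpleGraph.IsRooted {V : Type*} (G : SimpleGraph V) (r : V) (par : V → V)
    (depth : V → ℕ) : Prop where
  depth_lt : ∀ i, i ≠ r → depth (par i) < depth i
  adj_par : ∀ i, i ≠ r → G.Adj i (par i)
  eq_par : ∀ i j, G.Adj i j → (i ≠ r ∧ j = par i) ∨ (j ≠ r ∧ i = par j)

theorem SimpleGraph.IsTree.exists_isRooted {V : Type*} {G : SimpleGraph V} (hG : G.IsTree) :
    ∃ (r : V) (par : V → V) (depth : V → ℕ), G.IsRooted r par depth := by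
  classical
  obtain ⟨r⟩ := hG.connected.nonempty
  choose q hq hlen using fun i => (hG.connected r i).exists_path_of_dist
  have huniq : ∀ i j, G.Adj i j → G.dist r j < G.dist r i → j = (q i).penultimate := by
    intro i j hij hlt
    refine hG.isAcyclic.eq_penultimate_of_adj_end (hq i) hij
      (hG.isAcyclic.mem_support_of_ne_mem_support_of_adj_of_isPath (hq i) (hq j) hij fun hi => ?_)
    have h1 := SimpleGraph.dist_le ((q j).takeUntil i hi)
    have h2 := (q j).length_takeUntil_le_length hi
    rw [hlen] at h2
    omega
  have hnil : ∀ i, i ≠ r → ¬ (q i).Nil := fun i hi h => hi h.eq.symm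
  refine ⟨r, fun i => (q i).penultimate, G.dist r, ?_, ?_, ?_⟩
  · intro i hi
    have h1 := SimpleGraph.dist_le (q i).dropLast
    have h2 := (q i).length_dropLast_add_one (hnil i hi)
    rw [hlen] at h2
    omega
  · intro i hi
    exact ((q i).adj_penultimate (hnil i hi)).symm
  · intro i j hij
    rcases hG.dist_eq_dist_add_one_of_adj r hij with h | h
    · refine Or.inl ⟨?_, huniq i j hij (by omega)⟩
      rintro rfl
      simp at h
    · refine Or.inr ⟨?_, huniq j i hij.symm (by omega)⟩
      rintro rfl
      simp at h

theorem SimpleGraph.IsRooted.isTree {V : Type*} [Finite V] {G : SimpleGraph V} {r : V} {par : V → V}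
    {depth : V → ℕ} (h : G.IsRooted r par depth) : G.IsTree := by
  classical
  have := Fintype.ofFinite V
  have hreach : ∀ n i, depth i = n → G.Reachable i r := by
    intro n
    induction n using Nat.strong_induction_on with
    | _ n ih =>
      intro i hi
      by_cases hir : i = r
      · rw [hir]
      · exact (h.adj_par i hir).reachable.trans (ih _ (hi ▸ h.depth_lt i hir) _ rfl)
  have hconn : G.Connected :=
    { preconnected := fun i j => (hreach _ i rfl).trans (hreach _ j rfl).symm
      nonempty := ⟨r⟩ }
  refine SimpleGraph.isTree_iff_connected_and_card.2 ⟨hconn,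
    le_antisymm ?_ hconn.card_vert_le_card_edgeSet_add_one⟩
  have hsurj : Function.Surjective
      fun i : {i // i ≠ r} => (⟨s(i.1, par i.1), h.adj_par i.1 i.2⟩ : G.edgeSet) := by
    rintro ⟨e, he⟩
    induction e using Sym2.ind with
    | _ i j =>
      rcases h.eq_par i j he with ⟨hi, rfl⟩ | ⟨hj, rfl⟩
      · exact ⟨⟨i, hi⟩, rfl⟩
      · exact ⟨⟨j, hj⟩, Subtype.ext Sym2.eq_swap⟩
  have h1 : Nat.card G.edgeSet ≤ _ := Nat.card_le_card_of_surjective _ hsurj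
  have h2 : Nat.card {i // i ≠ r} + 1 = Nat.card V := by
    rw [Nat.card_eq_fintype_card, Nat.card_eq_fintype_card, Fintype.card_subtype_compl,
      Fintype.card_subtype_eq, Nat.sub_add_cancel (Fintype.card_pos_iff.2 ⟨r⟩)]
  omega

/-! ### Optimal labellings of a rooted tree -/

section Labelling

open Classical

variable {V : Type*} {X : V → Type*}

/-- Partial labels `x` and a set `t` of edges (an edge being named by its lower end) are *admissible*
for the weights `d` on the vertices in `S` if some vertex is labelled, the ends of the edges in `t`
have compatible labels, and the value `e` of the label at a vertex `i` is at least `-d i` plus the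
number of edges at `i` not belonging to `t`. -/
structure IsAdmissible (r : V) (par : V → V) (R : ∀ i, X i → X (par i) → Prop) (S : Finset V)
    (e : ∀ i, X i → ℤ) (d : V → ℤ) (x : ∀ i, Option (X i)) (t : V → Prop) : Prop where
  exists_ne_none : ∃ i ∈ S, x i ≠ none
  compat : ∀ i ∈ S, i ≠ r → t i → ∃ a b, x i = some a ∧ x (par i) = some b ∧ R i a b
  le_value : ∀ i ∈ S, ∀ a, x i = some a →
    -d i + (if i ≠ r ∧ ¬ t i then 1 else 0) +
      (∑ c ∈ S, if c ≠ r ∧ par c = i ∧ ¬ t c then 1 else 0) ≤ e i a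

theorem exists_forall_le_of_bounded {Y : Type*} [Nonempty Y] (f : Y → ℤ) {B : ℤ}
    (hB : ∀ y, f y ≤ B) : ∃ y, ∀ z, f z ≤ f y := by
  obtain ⟨_, ⟨y, rfl⟩, hy⟩ := Int.exists_greatest_of_bdd (P := fun v => ∃ y, f y = v)
    ⟨B, by rintro _ ⟨y, rfl⟩; exact hB y⟩ ⟨_, Classical.arbitrary Y, rfl⟩
  exact ⟨y, fun z => hy _ ⟨z, rfl⟩⟩

theorem nonempty_of_forall_isAdmissible {r : V} {par : V → V}
    {R : ∀ i, X i → X (par i) → Prop} {S : Finset V} {e : ∀ i, X i → ℤ}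
    (hbd : ∀ i, ∃ B, ∀ x, e i x ≤ B)
    (H : ∀ d : V → ℤ, ∑ i ∈ S, d i = 0 → ∃ x t, IsAdmissible r par R S e d x t)
    {l : V} (hl : l ∈ S) : Nonempty (X l) := by
  choose B hB using hbd
  -- The weights away from `l` are so small that no label there has a large enough value.
  set d : V → ℤ := fun i => if i = l then ∑ j ∈ S.erase l, (B j + 1) else -(B i + 1)
  obtain ⟨x, t, hx⟩ := H d (by
    rw [← Finset.add_sum_erase _ _ hl, Finset.sum_congr rfl fun i hi =>
      show d i = -(B i + 1) from if_neg (Finset.ne_of_mem_erase hi), Finset.sum_neg_distrib]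
    simp [d])
  obtain ⟨i, hi, hxi⟩ := hx.exists_ne_none
  obtain ⟨a, ha⟩ := Option.ne_none_iff_exists'.1 hxi
  by_cases hil : i = l
  · exact hil ▸ ⟨a⟩
  · have h1 := hx.le_value i hi a ha
    have h2 := hB i a
    have h3 : (0 : ℤ) ≤ if i ≠ r ∧ ¬ t i then 1 else 0 := by split_ifs <;> simp
    have h4 : (0 : ℤ) ≤ ∑ c ∈ S, if c ≠ r ∧ par c = i ∧ ¬ t c then 1 else 0 :=
      Finset.sum_nonneg fun c _ => by split_ifs <;> simp
    have h5 : d i = -(B i + 1) := if_neg hil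
    omega

/-- If there are admissible partial labels for all weights of total zero then some labelling has
total value at least its number of incompatible edges. The deepest vertex `l` is removed, the best
contribution that `l` can make being added to the value of the label of its parent; the weight to
use at `l` is minus the greatest value `M` of a label there. -/
theorem exists_labelling {r : V} {par : V → V} {depth : V → ℕ}
    (hdepth : ∀ i, i ≠ r → depth (par i) < depth i) (R : ∀ i, X i → X (par i) → Prop)
    [∀ i, Nonempty (X i)] (S : Finset V) (hr : r ∈ S) (hS : ∀ i ∈ S, i ≠ r → par i ∈ S)
    (e : ∀ i, X i → ℤ) (hbd : ∀ i, ∃ B, ∀ x, e i x ≤ B)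
    (H : ∀ d : V → ℤ, ∑ i ∈ S, d i = 0 → ∃ x t, IsAdmissible r par R S e d x t) :
    ∃ x : ∀ i, X i, (∑ i ∈ S, if i ≠ r ∧ ¬ R i (x i) (x (par i)) then (1 : ℤ) else 0) ≤
      ∑ i ∈ S, e i (x i) := by
  induction S using Finset.strongInduction generalizing e with
  | H S ih =>
    rcases (S.erase r).eq_empty_or_nonempty with hSr | hSr
    · obtain rfl : S = {r} := (Finset.erase_eq_empty_iff _ _).1 hSr |>.resolve_left
        (Finset.ne_empty_of_mem hr)
      obtain ⟨x, t, hx⟩ := H 0 (by simp)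
      obtain ⟨i, hi, hxi⟩ := hx.exists_ne_none
      rw [Finset.mem_singleton] at hi
      subst hi
      obtain ⟨a, ha⟩ := Option.ne_none_iff_exists'.1 hxi
      have := hx.le_value i hr a ha
      refine ⟨Function.update (fun _ => Classical.arbitrary _) i a, ?_⟩
      rw [Finset.sum_singleton, if_neg (by tauto), if_neg (by tauto)] at this
      rw [Finset.sum_singleton, Finset.sum_singleton, if_neg (by tauto), Function.update_self]
      simpa using this
    obtain ⟨l, hl, hmax⟩ := (S.erase r).exists_max_image depth hSr
    obtain ⟨hlr, hlS⟩ := Finset.mem_erase.1 hl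
    have hleaf : ∀ i ∈ S, i ≠ r → par i ≠ l := by
      rintro i hi hir rfl
      exact absurd (hdepth i hir) (not_lt.2 (hmax i (Finset.mem_erase.2 ⟨hir, hi⟩)))
    have hpl : par l ≠ l := hleaf l hlS hlr
    have hpS : par l ∈ S.erase l := Finset.mem_erase.2 ⟨hpl, hS l hlS hlr⟩
    obtain ⟨B, hB⟩ := hbd l
    obtain ⟨aM, haM⟩ := exists_forall_le_of_bounded (e l) hB
    choose best hbest using fun y : X (par l) =>
      exists_forall_le_of_bounded (fun a => e l a - if R l a y then 0 else 1) (B := B) fun a =>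
        (by have := hB a; split_ifs <;> omega)
    set g : X (par l) → ℤ := fun y => e l (best y) - if R l (best y) y then 0 else 1 with hg
    set e' := Function.update e (par l) fun y => e (par l) y + g y with he'
    have he'p : ∀ y, e' (par l) y = e (par l) y + g y := fun y => by
      rw [he', Function.update_self]
    have he'n : ∀ i, i ≠ par l → e' i = e i := fun i hi => Function.update_of_ne hi _ _
    have hgB : ∀ y, g y ≤ B := fun y => by
      have := hB (best y)
      simp only [hg]
      split_ifs <;> omega
    obtain ⟨x, hx⟩ := ih (S.erase l) (Finset.erase_ssubset hlS)
      (Finset.mem_erase.2 ⟨hlr.symm, hr⟩)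
      (fun i hi hir => Finset.mem_erase.2
        ⟨hleaf i (Finset.mem_of_mem_erase hi) hir, hS i (Finset.mem_of_mem_erase hi) hir⟩) e' (by
        intro i
        by_cases hi : i = par l
        · subst hi
          obtain ⟨B', hB'⟩ := hbd (par l)
          exact ⟨B' + B, fun y => (he'p y).trans_le (add_le_add (hB' y) (hgB y))⟩
        · rw [he'n i hi]
          exact hbd i) (by
        intro d' hd'
        set d : V → ℤ := Function.update (d' + Pi.single (par l) (e l aM)) l (-e l aM) with hd
        have hdl : d l = -e l aM := Function.update_self _ _ _
        have hdn : ∀ i, i ≠ l → d i = d' i + if i = par l then e l aM else 0 := fun i hi => by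
          rw [hd, Function.update_of_ne hi, Pi.add_apply, Pi.single_apply]
        obtain ⟨x, t, hx⟩ := H d (by
          rw [← Finset.add_sum_erase _ _ hlS, hdl, Finset.sum_congr rfl fun i hi =>
            hdn i (Finset.ne_of_mem_erase hi), Finset.sum_add_distrib, hd',
            Finset.sum_ite_eq' _ (par l), if_pos hpS]
          ring)
        have hchild : ∀ i ∈ S, (0 : ℤ) ≤ ∑ c ∈ S, if c ≠ r ∧ par c = i ∧ ¬ t c then 1 else 0 :=
          fun i _ => Finset.sum_nonneg fun c _ => by split_ifs <;> simp
        have htl : ∀ a, x l = some a → t l ∧ e l aM ≤ e l a := by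
          intro a ha
          have h1 := hx.le_value l hlS a ha
          have h2 := hchild l hlS
          have h3 := haM a
          by_cases htl : t l
          · rw [if_neg (by tauto)] at h1
            exact ⟨htl, by omega⟩
          · rw [if_pos ⟨hlr, htl⟩] at h1
            omega
        refine ⟨x, t, ?_, fun i hi => hx.compat i (Finset.mem_of_mem_erase hi), ?_⟩
        · obtain ⟨i, hi, hxi⟩ := hx.exists_ne_none
          by_cases hil : i = l
          · subst hil
            obtain ⟨a, ha⟩ := Option.ne_none_iff_exists'.1 hxi
            obtain ⟨-, b, -, hb, -⟩ := hx.compat i hlS hlr (htl a ha).1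
            exact ⟨par i, hpS, by simp [hb]⟩
          · exact ⟨i, Finset.mem_erase.2 ⟨hil, hi⟩, hxi⟩
        · intro i hi b hb
          obtain ⟨hil, hiS⟩ := Finset.mem_erase.1 hi
          have h1 := hx.le_value i hiS b hb
          rw [← Finset.add_sum_erase _ _ hlS, hdn i hil] at h1
          generalize (∑ c ∈ S.erase l, if c ≠ r ∧ par c = i ∧ ¬ t c then (1 : ℤ) else 0) = N at h1 ⊢
          generalize (if i ≠ r ∧ ¬ t i then (1 : ℤ) else 0) = A at h1 ⊢
          by_cases hip : i = par l
          · subst hip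
            rw [he'p]
            have hgb : e l aM - (if t l then 0 else 1) ≤ g b := by
              by_cases ht : t l
              · obtain ⟨a, b', ha, hb', hab⟩ := hx.compat l hlS hlr ht
                obtain rfl : b = b' := Option.some.inj (hb.symm.trans hb')
                have h2 := hbest b a
                have h3 := (htl a ha).2
                rw [if_pos hab] at h2
                rw [if_pos ht]
                exact le_trans (by omega) h2
              · have h2 := hbest b aM
                rw [if_neg ht]
                refine le_trans ?_ h2
                split_ifs <;> omega
            by_cases ht : t l
            · simp only [ht, not_true_eq_false, and_false, if_false, if_true] at h1 hgb
              omega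
            · simp only [ht, hlr, not_false_eq_true, and_true, ne_eq, if_true, if_false] at h1 hgb
              omega
          · rw [he'n i hip]
            rw [if_neg hip, if_neg fun h => hip h.2.1.symm] at h1
            omega)
    refine ⟨Function.update x l (best (x (par l))), ?_⟩
    have hxl : Function.update x l (best (x (par l))) l = best (x (par l)) :=
      Function.update_self _ _ _
    have hxn : ∀ i, i ≠ l → Function.update x l (best (x (par l))) i = x i := fun i hi =>
      Function.update_of_ne hi _ _
    set x' := Function.update x l (best (x (par l)))
    have hsum : ∑ i ∈ S.erase l, e' i (x i) = g (x (par l)) + ∑ i ∈ S.erase l, e i (x i) := by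
      rw [← Finset.add_sum_erase _ _ hpS, ← Finset.add_sum_erase _ (fun i => e i (x i)) hpS, he'p,
        Finset.sum_congr rfl fun i hi => by rw [he'n i (Finset.ne_of_mem_erase hi)]]
      ring
    rw [hsum] at hx
    rw [← Finset.add_sum_erase _ _ hlS, ← Finset.add_sum_erase _ (fun i => e i (x' i)) hlS, hxl,
      hxn _ hpl, Finset.sum_congr rfl fun i hi => show e i (x' i) = e i (x i) by
        rw [hxn i (Finset.ne_of_mem_erase hi)],
      Finset.sum_congr rfl fun i hi =>
        show (if i ≠ r ∧ ¬ R i (x' i) (x' (par i)) then (1 : ℤ) else 0) =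
          if i ≠ r ∧ ¬ R i (x i) (x (par i)) then 1 else 0 by
        by_cases hir : i = r
        · simp [hir]
        · rw [hxn i (Finset.ne_of_mem_erase hi), hxn _ (hleaf i (Finset.mem_of_mem_erase hi) hir)]]
    have hgx : (if l ≠ r ∧ ¬ R l (best (x (par l))) (x (par l)) then (1 : ℤ) else 0) +
        g (x (par l)) = e l (best (x (par l))) := by
      simp only [hg, hlr, ne_eq, not_false_eq_true, true_and]
      split_ifs <;> simp_all
    omega

end Labelling

/-! ### Line bundles of given multidegree -/

namespace RationalTree

open Filter

variable {k : Type u} [Field k] {C : RationalTree k}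

theorem finite_nodes_on (C : RationalTree k) (i : C.Comp) : {q | C.IsNode (C.param i q)}.Finite := by
  have h : {q | C.IsNode (C.param i q)} ⊆
      ⋃ j ∈ {j | j ≠ i}, {q | C.param i q ∈ Set.range (C.param j)} := by
    rintro q ⟨j, j', hne, hj, hj'⟩
    simp only [Set.mem_iUnion]
    by_cases hji : j = i
    · exact ⟨j', fun h => hne (hji.trans h.symm), hj'⟩
    · exact ⟨j, hji, hj⟩
  refine (Set.Finite.biUnion (Set.toFinite _) fun j hj => Set.Subsingleton.finite ?_).subset h
  intro q hq q' hq'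
  exact C.param_injective i
    (C.inter_subsingleton i j (Ne.symm hj) ⟨⟨q, rfl⟩, hq⟩ ⟨⟨q', rfl⟩, hq'⟩)

namespace VectorBundle

/-- The line bundle glued from trivial bundles over the sets `base a` along the transition functions
`u b / u a`. All fibres are `k`, and `u a` is the coordinate over `base a`. -/
noncomputable def ofUnits {ι : Type u} (base : ι → Set C.Pt) (hopen : ∀ a, IsOpen (base a))
    (hcover : ∀ p, ∃ a, p ∈ base a) (u : ι → C.Pt → k) (hu : ∀ a p, u a p ≠ 0)
    (hreg : ∀ a b p, p ∈ base a → p ∈ base b → C.RegularAt (fun q => (u a q)⁻¹ * u b q) p) :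
    VectorBundle C 1 where
  fib _ := k
  Idx := ι
  base := base
  isOpen_base := hopen
  base_cover := hcover
  chart a p := (LinearEquiv.smulOfNeZero k k (u a p) (hu a p)).trans
    (LinearEquiv.funUnique (Fin 1) k k).symm
  regular_transition a b p ha hb i j := by
    convert hreg a b p ha hb using 2 with q
    rw [Subsingleton.elim i 0, Subsingleton.elim j 0]
    simp [LinearEquiv.smulOfNeZero, LinearEquiv.smulOfUnit, Units.smul_def, mul_comm]

theorem congr_trans_rid_apply {V : Type*} [AddCommGroup V] [Module k V] {r : ℕ}
    (e : V ≃ₗ[k] (Fin r → k)) (f : k ≃ₗ[k] (Fin 1 → k)) (v : V ⊗[k] k) (j : Fin r) :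
    ((TensorProduct.congr e (f.trans (LinearEquiv.funUnique (Fin 1) k k))).trans
      (TensorProduct.rid k (Fin r → k))) v j = e (TensorProduct.rid k V v) j * f 1 0 := by
  induction v with
  | zero => simp
  | add v w hv hw => simp only [map_add, Pi.add_apply, hv, hw, add_mul]
  | tmul v c =>
    have hc : f c 0 = c * f 1 0 := by
      rw [← smul_eq_mul, ← Pi.smul_apply, ← map_smul, smul_eq_mul, mul_one]
    simp [hc]
    ring

end VectorBundle

/-- Given distinct points `z` and `w` of the `i`-th component, a function on `C` without zeros whose
restriction to that component is the `d`-th power of the quotient of their linear forms, away from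
the two points. -/
noncomputable def quotientPow (C : RationalTree k) (i : C.Comp) (z w : Fin 2 → k) (d : ℤ)
    (p : C.Pt) : k :=
  open Classical in
  if h : ∃ (x : Fin 2 → k) (hx : x ≠ 0), C.param i (P1.mk x hx) = p ∧
    MvPolynomial.eval x (P1.lin z) ≠ 0 ∧ MvPolynomial.eval x (P1.lin w) ≠ 0
  then (MvPolynomial.eval h.choose (P1.lin z) / MvPolynomial.eval h.choose (P1.lin w)) ^ d
  else 1

theorem quotientPow_ne_zero (C : RationalTree k) (i : C.Comp) (z w : Fin 2 → k) (d : ℤ)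
    (p : C.Pt) : C.quotientPow i z w d p ≠ 0 := by
  unfold quotientPow
  split_ifs with h
  · obtain ⟨-, -, h1, h2⟩ := h.choose_spec
    exact zpow_ne_zero _ (div_ne_zero h1 h2)
  · exact one_ne_zero

theorem quotientPow_param (C : RationalTree k) (i : C.Comp) {z w : Fin 2 → k} (d : ℤ)
    {x : Fin 2 → k} (hx : x ≠ 0) (h1 : MvPolynomial.eval x (P1.lin z) ≠ 0)
    (h2 : MvPolynomial.eval x (P1.lin w) ≠ 0) :
    C.quotientPow i z w d (C.param i (P1.mk x hx)) =
      (MvPolynomial.eval x (P1.lin z) / MvPolynomial.eval x (P1.lin w)) ^ d := by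
  unfold quotientPow
  have h : ∃ (y : Fin 2 → k) (hy : y ≠ 0), C.param i (P1.mk y hy) = C.param i (P1.mk x hx) ∧
    MvPolynomial.eval y (P1.lin z) ≠ 0 ∧ MvPolynomial.eval y (P1.lin w) ≠ 0 := ⟨x, hx, rfl, h1, h2⟩
  rw [dif_pos h]
  obtain ⟨hy, he, -, -⟩ := h.choose_spec
  obtain ⟨c, hc, hce⟩ := (P1.mk_eq_mk_iff _ _).1 (C.param_injective i he)
  rw [hce, P1.eval_smul_of_isHomogeneous (P1.lin_isHomogeneous z),
    P1.eval_smul_of_isHomogeneous (P1.lin_isHomogeneous w),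
    mul_div_mul_left _ _ (pow_ne_zero _ hc)]

/-- Gluing data of the line bundle `𝒪(∑ᵢ dᵢ zᵢ)`, for smooth points `zᵢ` on the components: one
open set is the complement of the points `zᵢ` and another, for each `i`, a neighbourhood of `zᵢ` in
the `i`-th component; `u a` is the coordinate over `base a`, and `τ i` a nowhere zero section of the
twist by `𝒪(-dᵢ)` along the `i`-th component. -/
theorem exists_units [Infinite k] (C : RationalTree k) (d : C.Comp → ℤ) :
    ∃ (base : Option C.Comp → Set C.Pt) (u : Option C.Comp → C.Pt → k)
      (τ : C.Comp → ∀ x : Fin 2 → k, x ≠ 0 → k),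
      (∀ a, IsOpen (base a)) ∧ (∀ p, ∃ a, p ∈ base a) ∧ (∀ a p, u a p ≠ 0) ∧
      (∀ a b p, p ∈ base a → p ∈ base b → C.RegularAt (fun q => (u a q)⁻¹ * u b q) p) ∧
      (∀ i x hx, τ i x hx ≠ 0) ∧
      ∀ i a q, C.param i q ∈ base a →
        P1.RegularOfDegreeAt (-d i) (fun x hx => u a (C.param i (P1.mk x hx)) * τ i x hx) q := by
  classical
  have hz : ∀ i, ∃ (z : Fin 2 → k) (hz : z ≠ 0), ¬ C.IsNode (C.param i (P1.mk z hz)) := by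
    intro i
    obtain ⟨q, hq⟩ := (C.finite_nodes_on i).infinite_compl.nonempty
    obtain ⟨z, hz, rfl⟩ := P1.exists_mk q
    exact ⟨z, hz, hq⟩
  choose z hz hzn using hz
  have hw : ∀ i, ∃ (w : Fin 2 → k) (hw : w ≠ 0), P1.mk w hw ≠ P1.mk (z i) (hz i) := by
    intro i
    obtain ⟨q, hq⟩ := (Set.finite_singleton (P1.mk (z i) (hz i))).infinite_compl.nonempty
    obtain ⟨w, hw, rfl⟩ := P1.exists_mk q
    exact ⟨w, hw, hq⟩
  choose w hw hwz using hw
  have hlz : ∀ i x (hx : x ≠ 0), MvPolynomial.eval x (P1.lin (z i)) ≠ 0 ↔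
      P1.mk x hx ≠ P1.mk (z i) (hz i) := fun i x hx => (P1.eval_lin_eq_zero_iff (hz i) hx).not
  have hlw : ∀ i x (hx : x ≠ 0), MvPolynomial.eval x (P1.lin (w i)) ≠ 0 ↔
      P1.mk x hx ≠ P1.mk (w i) (hw i) := fun i x hx => (P1.eval_lin_eq_zero_iff (hw i) hx).not
  have hnode : ∀ {p : C.Pt} {i j q q'}, ¬ C.IsNode p → C.param i q = p → C.param j q' = p →
      i = j := by
    intro p i j q q' hp hi hj
    by_contra hij
    exact hp ⟨i, j, hij, ⟨q, hi⟩, ⟨q', hj⟩⟩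
  let base : Option C.Comp → Set C.Pt := fun a => a.elim
    {p | ∀ i, p ≠ C.param i (P1.mk (z i) (hz i))}
    fun i => {p | ¬ C.IsNode p ∧ ∃ q, q ≠ P1.mk (w i) (hw i) ∧ C.param i q = p}
  let u : Option C.Comp → C.Pt → k := fun a => a.elim (fun _ => 1)
    fun i => C.quotientPow i (z i) (w i) (d i)
  let τ : C.Comp → ∀ x : Fin 2 → k, x ≠ 0 → k := fun i x hx =>
    if P1.mk x hx = P1.mk (z i) (hz i) then MvPolynomial.eval x (P1.lin (w i)) ^ (-d i)
    else MvPolynomial.eval x (P1.lin (z i)) ^ (-d i)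
  have hu : ∀ a p, u a p ≠ 0 := by
    rintro (_ | i) p
    · exact one_ne_zero
    · exact C.quotientPow_ne_zero _ _ _ _ _
  have hev : ∀ (q q' : P1 k), q' ≠ q → ∀ᶠ y in 𝓝 q', y ≠ q := fun q q' h =>
    P1.eventually_nhds_iff.2 ⟨h, by simp⟩
  -- Away from `z i` and `w i` the coordinate `u (some i)` is regular along the component
  have hureg : ∀ i q, q ≠ P1.mk (z i) (hz i) → q ≠ P1.mk (w i) (hw i) →
      P1.RegularAt (fun y => u (some i) (C.param i y)) q := by
    intro i q hqz hqw
    obtain ⟨x, hx, rfl⟩ := P1.exists_mk q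
    have h1 := P1.regularOfDegreeAt_eval (P1.lin_isHomogeneous (z i)) (P1.mk x hx)
    have h2 := P1.regularOfDegreeAt_eval (P1.lin_isHomogeneous (w i)) (P1.mk x hx)
    have h3 := ((h1.mul (h2.inv ((hlw i x hx).2 hqw)).1)).zpow
      (mul_ne_zero ((hlz i x hx).2 hqz) (inv_ne_zero ((hlw i x hx).2 hqw))) (d i)
    rw [add_neg_cancel, mul_zero] at h3
    refine h3.congr ?_
    filter_upwards [hev _ _ hqz, hev _ _ hqw] with y hyz hyw v hv hvy
    subst hvy
    rw [← div_eq_mul_inv]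
    exact C.quotientPow_param i (d i) hv ((hlz i v hv).2 hyz) ((hlw i v hv).2 hyw)
  have hinvreg : ∀ (f : P1 k → k) q, P1.RegularAt f q → f q ≠ 0 →
      P1.RegularAt (fun y => (f y)⁻¹) q := by
    intro f q hf h0
    obtain ⟨x, hx, rfl⟩ := P1.exists_mk q
    exact (P1.RegularOfDegreeAt.inv hf h0).1
  refine ⟨base, u, τ, ?_, ?_, hu, ?_, ?_, ?_⟩
  · rintro (_ | i)
    · refine isOpen_iff.2 fun j => P1.isOpen_of_finite_compl ?_
      have h : (C.param j ⁻¹' base none)ᶜ ⊆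
          ⋃ i, {q | C.param j q = C.param i (P1.mk (z i) (hz i))} := by
        intro q hq
        simpa [base] using hq
      refine (Set.finite_iUnion fun i => Set.Subsingleton.finite ?_).subset h
      intro q hq q' hq'
      exact C.param_injective j (Eq.trans hq (Eq.symm hq'))
    · refine isOpen_iff.2 fun j => ?_
      by_cases hij : i = j
      · subst hij
        refine P1.isOpen_of_finite_compl
          (((C.finite_nodes_on i).union (Set.finite_singleton (P1.mk (w i) (hw i)))).subset ?_)
        intro q hq
        by_contra hcon
        simp only [Set.mem_union, Set.mem_singleton_iff, not_or] at hcon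
        exact hq ⟨hcon.1, q, hcon.2, rfl⟩
      · convert isOpen_empty
        refine Set.eq_empty_of_forall_notMem ?_
        rintro q ⟨hq, q', -, hq'⟩
        exact hij (hnode hq hq' rfl)
  · intro p
    by_cases hp : ∃ i, p = C.param i (P1.mk (z i) (hz i))
    · obtain ⟨i, rfl⟩ := hp
      exact ⟨some i, hzn i, _, (hwz i).symm, rfl⟩
    · push Not at hp
      exact ⟨none, hp⟩
  · rintro (_ | i) (_ | j) p ha hb j' q hq
    · simpa [u] using P1.regularAt_const (1 : k) q
    · obtain ⟨hp, q', hq', hq'p⟩ := hb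
      obtain rfl := hnode hp hq'p hq
      obtain rfl := C.param_injective _ (hq'p.trans hq.symm)
      have := hureg j q' (fun h => ha j (by rw [← h, hq])) hq'
      simpa [u] using this
    · obtain ⟨hp, q', hq', hq'p⟩ := ha
      obtain rfl := hnode hp hq'p hq
      obtain rfl := C.param_injective _ (hq'p.trans hq.symm)
      have := hureg i q' (fun h => hb i (by rw [← h, hq])) hq'
      simpa [u] using hinvreg _ _ this (hu _ _)
    · obtain ⟨hp, q', hq', hq'p⟩ := ha
      obtain ⟨-, q'', hq'', hq''p⟩ := hb
      obtain rfl := hnode hp hq'p hq''p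
      have : (fun y => (u (some i) y)⁻¹ * u (some i) y) = fun _ => 1 :=
        funext fun y => inv_mul_cancel₀ (hu _ _)
      rw [this]
      exact P1.regularAt_const 1 q
  · intro i x hx
    simp only [τ]
    split_ifs with h
    · exact zpow_ne_zero _ ((hlw i x hx).2 (h ▸ (hwz i).symm))
    · exact zpow_ne_zero _ ((hlz i x hx).2 h)
  · rintro i (_ | j) q hq
    · obtain ⟨x, hx, rfl⟩ := P1.exists_mk q
      have hqz : P1.mk x hx ≠ P1.mk (z i) (hz i) := fun h => hq i (by rw [h])
      have h1 := (P1.regularOfDegreeAt_eval (P1.lin_isHomogeneous (z i)) (P1.mk x hx)).zpow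
        ((hlz i x hx).2 hqz) (-d i)
      rw [Nat.cast_one, mul_one] at h1
      refine h1.congr ?_
      filter_upwards [hev _ _ hqz] with y hyz v hv hvy
      subst hvy
      simp [u, τ, hyz]
    · obtain ⟨hp, q', hq', hq'p⟩ := hq
      obtain rfl := hnode hp hq'p rfl
      obtain rfl := C.param_injective _ hq'p
      obtain ⟨x, hx, rfl⟩ := P1.exists_mk q'
      have h1 := (P1.regularOfDegreeAt_eval (P1.lin_isHomogeneous (w j)) (P1.mk x hx)).zpow
        ((hlw j x hx).2 hq') (-d j)
      rw [Nat.cast_one, mul_one] at h1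
      refine h1.congr ?_
      filter_upwards [hev _ _ hq'] with y hyw v hv hvy
      subst hvy
      by_cases hyz : P1.mk v hv = P1.mk (z j) (hz j)
      · have : C.quotientPow j (z j) (w j) (d j) (C.param j (P1.mk v hv)) = 1 := by
          unfold quotientPow
          rw [dif_neg]
          rintro ⟨x, hx, he, h1, -⟩
          exact (hlz j x hx).1 h1 ((C.param_injective j he).trans hyz)
        simp only [u, τ, hyz, if_true, Option.elim]
        rw [← hyz, this, one_mul]
      · have h1 := (hlz j v hv).2 hyz
        have h2 := (hlw j v hv).2 hyw
        have : C.quotientPow j (z j) (w j) (d j) (C.param j (P1.mk v hv)) = _ :=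
          C.quotientPow_param j (d j) hv h1 h2
        simp only [u, τ, hyz, if_false, Option.elim, this, div_zpow, zpow_neg]
        field_simp

/-- If every twist of `E` by a line bundle of degree zero has a nonzero section then, for every
multidegree `d` of total degree zero, there is a nonzero family `s` of vectors of `E` that along
each component is proportional to a section of `E ⊗ 𝒪(dᵢ)`. -/
theorem VectorBundle.exists_homSections [Infinite k] {r : ℕ} (E : VectorBundle C r)
    (h₀ : ∀ L : VectorBundle C 1, L.HasDegree 0 → (E.twist L).H0 ≠ ⊥) (d : C.Comp → ℤ)
    (hd : ∑ i, d i = 0) :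
    ∃ (s : ∀ p, E.fib p)
      (σ : ∀ (i : C.Comp) (x : Fin 2 → k) (hx : x ≠ 0), E.fib (C.param i (P1.mk x hx))),
      (∃ p, s p ≠ 0) ∧ (∀ i, E.IsHomSection i (d i) (σ i)) ∧
      ∀ i x hx, ∃ c : k, c ≠ 0 ∧ σ i x hx = c • s (C.param i (P1.mk x hx)) := by
  obtain ⟨base, u, τ, hopen, hcover, hu, hreg, hτ0, hτ⟩ := C.exists_units d
  let L := VectorBundle.ofUnits base hopen hcover u hu hreg
  have hL : L.HasDegree 0 := by
    refine ⟨d, fun i => ⟨τ i, hτ0 i, fun a q hq => ?_⟩, hd⟩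
    exact hτ i a q hq
  obtain ⟨t, ht, ht0⟩ := Submodule.exists_mem_ne_zero_of_ne_bot (h₀ L hL)
  let s : ∀ p, E.fib p := fun p => TensorProduct.rid k (E.fib p) (t p)
  have hchart : ∀ p (a : E.Idx) (b : Option C.Comp) j, (E.twist L).chart ((a, b) : E.Idx × L.Idx) p (t p) j = E.chart a p (s p) j * u b p := by
    intro p a b j
    refine (VectorBundle.congr_trans_rid_apply (E.chart a p) (L.chart b p) (t p) j).trans ?_
    congr 1
    exact (mul_one _)
  refine ⟨s, fun i x hx => (τ i x hx)⁻¹ • s _, ?_, ?_, fun i x hx =>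
    ⟨_, inv_ne_zero (hτ0 i x hx), rfl⟩⟩
  · obtain ⟨p, hp⟩ := Function.ne_iff.1 ht0
    exact ⟨p, fun h => hp ((TensorProduct.rid k (E.fib p)).map_eq_zero_iff.1 h)⟩
  · intro i a q ha j
    obtain ⟨b, hb⟩ := hcover (C.param i q)
    obtain ⟨x, hx, rfl⟩ := P1.exists_mk q
    have h1 : P1.RegularAt _ _ := ht (C.param i (P1.mk x hx)) (a, b) ⟨ha, hb⟩ j i _ rfl
    have h2 := ((hτ i b _ hb).inv (mul_ne_zero (hu _ _) (hτ0 _ _ _))).1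
    have h3 := P1.RegularOfDegreeAt.mul h1 h2
    rw [zero_add, neg_neg] at h3
    refine h3.congr (Eventually.of_forall fun _ y hy _ => ?_)
    have h4 := hu b (C.param i (P1.mk y hy))
    refine Eq.trans ?_ (congrArg (· * _) (hchart (C.param i (P1.mk y hy)) a b j).symm)
    simp only [map_smul, Pi.smul_apply, smul_eq_mul, mul_inv]
    field_simp

end RationalTree

/-! ### Line subbundles along the components -/

namespace RationalTree

open Filter

variable {k : Type u} [Field k] {C : RationalTree k}

/-- A root of the dual graph of `C`, the parent and the depth of each component, and the point in
which each component other than the root meets its parent. -/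
structure Rooting (C : RationalTree k) where
  root : C.Comp
  par : C.Comp → C.Comp
  depth : C.Comp → ℕ
  node : C.Comp → C.Pt
  isRooted : (SimpleGraph.fromRel fun i j =>
    (Set.range (C.param i) ∩ Set.range (C.param j)).Nonempty).IsRooted root par depth
  node_mem : ∀ i, i ≠ root → node i ∈ Set.range (C.param i)
  node_mem_par : ∀ i, i ≠ root → node i ∈ Set.range (C.param (par i))

theorem nonempty_rooting (C : RationalTree k) : Nonempty C.Rooting := by
  obtain ⟨r, par, depth, h⟩ := C.dualGraph_isTree.exists_isRooted
  have hmeet : ∀ i, ∃ p, i ≠ r → p ∈ Set.range (C.param i) ∧ p ∈ Set.range (C.param (par i)) := by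
    intro i
    by_cases hi : i = r
    · obtain ⟨q⟩ : Nonempty (P1 k) := ⟨P1.mk ![1, 0] fun h => by simpa using congrFun h 0⟩
      exact ⟨C.param i q, fun h => absurd hi h⟩
    · obtain ⟨-, ⟨p, hp, hp'⟩ | ⟨p, hp, hp'⟩⟩ := h.adj_par i hi
      · exact ⟨p, fun _ => ⟨hp, hp'⟩⟩
      · exact ⟨p, fun _ => ⟨hp', hp⟩⟩
  choose node hnode using hmeet
  exact ⟨⟨r, par, depth, node, h, fun i hi => (hnode i hi).1, fun i hi => (hnode i hi).2⟩⟩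

namespace Rooting

variable (ρ : C.Rooting)

theorem depth_lt {i : C.Comp} (hi : i ≠ ρ.root) : ρ.depth (ρ.par i) < ρ.depth i :=
  ρ.isRooted.depth_lt i hi

theorem par_ne {i : C.Comp} (hi : i ≠ ρ.root) : ρ.par i ≠ i := fun h =>
  (ρ.depth_lt hi).ne (by rw [h])

theorem eq_par_of_mem {i j : C.Comp} (hij : i ≠ j) {p : C.Pt} (hi : p ∈ Set.range (C.param i))
    (hj : p ∈ Set.range (C.param j)) :
    (i ≠ ρ.root ∧ j = ρ.par i ∧ p = ρ.node i) ∨ (j ≠ ρ.root ∧ i = ρ.par j ∧ p = ρ.node j) := by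
  rcases ρ.isRooted.eq_par i j ⟨hij, Or.inl ⟨p, hi, hj⟩⟩ with ⟨h, rfl⟩ | ⟨h, rfl⟩
  · exact Or.inl ⟨h, rfl, C.inter_subsingleton _ _ hij ⟨hi, hj⟩ ⟨ρ.node_mem i h, ρ.node_mem_par i h⟩⟩
  · exact Or.inr ⟨h, rfl, C.inter_subsingleton _ _ hij ⟨hi, hj⟩ ⟨ρ.node_mem_par j h, ρ.node_mem j h⟩⟩

/-- Only two components pass through a node, since the dual graph has no triangles. -/
theorem eq_or_eq_par_of_node_mem {c i : C.Comp} (hc : c ≠ ρ.root)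
    (h : ρ.node c ∈ Set.range (C.param i)) : i = c ∨ i = ρ.par c := by
  by_contra! hcon
  rcases ρ.eq_par_of_mem hcon.1 h (ρ.node_mem c hc) with ⟨hi, hci, -⟩ | ⟨-, hic, -⟩
  · have h1 := ρ.depth_lt hi
    have h2 := ρ.depth_lt hc
    rw [← hci] at h1
    rcases ρ.eq_par_of_mem hcon.2 h (ρ.node_mem_par c hc) with ⟨-, h3, -⟩ | ⟨hp, h3, -⟩
    · exact ρ.par_ne hc (h3.trans hci.symm)
    · have h4 := ρ.depth_lt hp
      rw [← h3] at h4
      omega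
  · exact hcon.2 hic

theorem node_injective {c c' : C.Comp} (hc : c ≠ ρ.root) (hc' : c' ≠ ρ.root)
    (h : ρ.node c = ρ.node c') : c = c' := by
  rcases ρ.eq_or_eq_par_of_node_mem hc (h ▸ ρ.node_mem c' hc') with h1 | h1
  · exact h1.symm
  · rcases ρ.eq_or_eq_par_of_node_mem hc' (h ▸ ρ.node_mem c hc) with h2 | h2
    · exact h2
    · have h3 := ρ.depth_lt hc
      have h4 := ρ.depth_lt hc'
      rw [← h1] at h3
      rw [← h2] at h4
      omega

end Rooting

namespace VectorBundle

variable {r : ℕ} {E : VectorBundle C r}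

/-- The line in the fibre at `p` given by a line subbundle along the `i`-th component. (It is zero
if `p` does not lie on the component.) -/
def LineOn.line {i : C.Comp} (l : E.LineOn i) (p : C.Pt) : Submodule k (E.fib p) :=
  Submodule.span k {v | ∃ (x : Fin 2 → k) (hx : x ≠ 0) (h : C.param i (P1.mk x hx) = p),
    h ▸ l.sec x hx = v}

theorem LineOn.line_param {i : C.Comp} (l : E.LineOn i) (x : Fin 2 → k) (hx : x ≠ 0) :
    l.line (C.param i (P1.mk x hx)) = Submodule.span k {l.sec x hx} := by
  refine le_antisymm (Submodule.span_le.2 ?_) (Submodule.span_mono ?_)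
  · rintro _ ⟨y, hy, h, rfl⟩
    obtain ⟨c, hc, rfl⟩ := (P1.mk_eq_mk_iff _ _).1 (C.param_injective i h)
    refine Submodule.mem_span_singleton.2 ⟨c ^ (-l.deg), ?_⟩
    obtain ⟨a, ha⟩ := E.base_cover (C.param i (P1.mk x hx))
    refine (E.chart a _).injective (funext fun j => ?_)
    rw [map_smul, Pi.smul_apply, smul_eq_mul]
    refine ((l.isHomSection a _ ha j).apply_smul hc hy).symm.trans ?_
    have hcast : ∀ p (h : C.param i (P1.mk (c • x) hy) = p),
        E.chart a _ (l.sec (c • x) hy) j = E.chart a p (h ▸ l.sec (c • x) hy) j := by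
      rintro _ rfl
      rfl
    exact hcast _ h
  · rintro _ rfl
    exact ⟨x, hx, rfl, rfl⟩

/-- If all twists of `E` by line bundles of degree zero have sections, then there are line
subbundles along the components whose total degree is at least the number of nodes at which they
do not agree. -/
theorem exists_lineOn [IsAlgClosed k] (E : VectorBundle C r) (ρ : C.Rooting)
    (h₀ : ∀ L : VectorBundle C 1, L.HasDegree 0 → (E.twist L).H0 ≠ ⊥) :
    ∃ l : ∀ i, E.LineOn i,
      (∑ i, open Classical in if i ≠ ρ.root ∧
        (l i).line (ρ.node i) ≠ (l (ρ.par i)).line (ρ.node i) then (1 : ℤ) else 0) ≤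
      ∑ i, (l i).deg := by
  classical
  have : Infinite k := IsAlgClosed.instInfinite
  obtain ⟨q₀⟩ : Nonempty (P1 k) := inferInstance
  obtain ⟨x₀, hx₀, rfl⟩ := P1.exists_mk q₀
  have hbd : ∀ i, ∃ B : ℤ, ∀ l : E.LineOn i, l.deg ≤ B := by
    intro i
    obtain ⟨B, hB⟩ := E.exists_degree_bound i
    refine ⟨B, fun l => ?_⟩
    have := hB _ _ l.isHomSection ⟨x₀, hx₀, l.sec_ne_zero _ _⟩
    omega
  let R : ∀ i, E.LineOn i → E.LineOn (ρ.par i) → Prop := fun i a b =>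
    a.line (ρ.node i) = b.line (ρ.node i)
  have H : ∀ d : C.Comp → ℤ, ∑ i, d i = 0 → ∃ x t,
      IsAdmissible ρ.root ρ.par R Finset.univ (fun i (l : E.LineOn i) => l.deg) d x t := by
    intro d hd
    obtain ⟨s, σ, ⟨p, hp⟩, hσ, hσs⟩ := E.exists_homSections h₀ d hd
    let t : C.Comp → Prop := fun i => s (ρ.node i) ≠ 0
    let pre : C.Comp → C.Comp → P1 k := fun i c =>
      if h : ∃ q, C.param i q = ρ.node c then h.choose else P1.mk x₀ hx₀
    have hpre : ∀ i c, c ≠ ρ.root → (c = i ∨ ρ.par c = i) → C.param i (pre i c) = ρ.node c := by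
      intro i c hc hci
      have h : ∃ q, C.param i q = ρ.node c := by
        rcases hci with rfl | rfl
        · exact ρ.node_mem c hc
        · exact ρ.node_mem_par c hc
      simp only [pre, dif_pos h]
      exact h.choose_spec
    let N : C.Comp → Finset C.Comp := fun i =>
      Finset.univ.filter fun c => c ≠ ρ.root ∧ (c = i ∨ ρ.par c = i) ∧ ¬ t c
    have hN : ∀ i, (((N i).image (pre i)).card : ℤ) = (if i ≠ ρ.root ∧ ¬ t i then 1 else 0) +
        ∑ c, if c ≠ ρ.root ∧ ρ.par c = i ∧ ¬ t c then 1 else 0 := by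
      intro i
      rw [Finset.card_image_of_injOn, Finset.card_filter, ← Finset.sum_ite_eq' Finset.univ i
        (fun c => if c ≠ ρ.root ∧ ¬ t c then (1 : ℤ) else 0) |>.trans (if_pos (Finset.mem_univ i)),
        ← Finset.sum_add_distrib]
      · push_cast
        refine Finset.sum_congr rfl fun c _ => ?_
        by_cases hc : c = ρ.root
        · simp [hc]
        · by_cases hci : c = i
          · subst hci
            simp [hc, ρ.par_ne hc]
          · simp [hc, hci]
      · intro c hc c' hc' h
        simp only [N, Finset.coe_filter, Finset.mem_univ, true_and, Set.mem_ofPred_eq] at hc hc'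
        exact ρ.node_injective hc.1 hc'.1 (by
          rw [← hpre i c hc.1 hc.2.1, ← hpre i c' hc'.1 hc'.2.1, h])
    have hsat : ∀ i, ∃ o : Option (E.LineOn i), ((∃ x hx, σ i x hx ≠ 0) → o ≠ none) ∧
        ∀ l, o = some l → -d i + ((N i).image (pre i)).card ≤ l.deg ∧
          ∀ x hx, ∃ c : k, σ i x hx = c • l.sec x hx := by
      intro i
      by_cases hi : ∃ x hx, σ i x hx ≠ 0
      · obtain ⟨l, hl⟩ := (hσ i).exists_lineOn hi ((N i).image (pre i)) (by
          intro x hx hxN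
          obtain ⟨c, hc, hcx⟩ := Finset.mem_image.1 hxN
          simp only [N, Finset.mem_filter, Finset.mem_univ, true_and, t, not_not] at hc
          obtain ⟨b, -, hb⟩ := hσs i x hx
          have : C.param i (P1.mk x hx) = ρ.node c := by rw [← hcx, hpre i c hc.1 hc.2.1]
          rw [hb, this, hc.2.2, smul_zero])
        exact ⟨some l, by simp, by rintro _ ⟨⟩; exact hl⟩
      · exact ⟨none, fun h => absurd h hi, by simp⟩
    choose o ho hol using hsat
    -- Where `s` does not vanish, it spans the lines of the subbundles that its restrictions generate
    have hline : ∀ i p, p ∈ Set.range (C.param i) → s p ≠ 0 →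
        ∃ l, o i = some l ∧ l.line p = Submodule.span k {s p} := by
      rintro i _ ⟨q, rfl⟩ hs
      obtain ⟨x, hx, rfl⟩ := P1.exists_mk q
      obtain ⟨b, hb0, hb⟩ := hσs i x hx
      have hne : σ i x hx ≠ 0 := hb ▸ smul_ne_zero hb0 hs
      obtain ⟨l, hl⟩ := Option.ne_none_iff_exists'.1 (ho i ⟨x, hx, hne⟩)
      refine ⟨l, hl, ?_⟩
      obtain ⟨c, hc⟩ := (hol i l hl).2 x hx
      have hc0 : c ≠ 0 := by
        rintro rfl
        exact hne (by rw [hc, zero_smul])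
      rw [l.line_param, ← Submodule.span_singleton_smul_eq (IsUnit.mk0 c hc0), ← hc, hb,
        Submodule.span_singleton_smul_eq (IsUnit.mk0 b hb0)]
    refine ⟨o, t, ?_, ?_, ?_⟩
    · obtain ⟨i, hi⟩ := C.param_cover p
      obtain ⟨l, hl, -⟩ := hline i p hi hp
      exact ⟨i, Finset.mem_univ i, by simp [hl]⟩
    · intro i _ hi hti
      obtain ⟨a, ha, ha'⟩ := hline i _ (ρ.node_mem i hi) hti
      obtain ⟨b, hb, hb'⟩ := hline _ _ (ρ.node_mem_par i hi) hti
      exact ⟨a, b, ha, hb, ha'.trans hb'.symm⟩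
    · intro i _ l hl
      have := (hol i l hl).1
      rw [hN] at this
      rw [add_assoc]
      convert this
  have : ∀ i, Nonempty (E.LineOn i) := fun i =>
    nonempty_of_forall_isAdmissible hbd H (Finset.mem_univ i)
  obtain ⟨x, hx⟩ := exists_labelling (fun i hi => ρ.depth_lt hi) R Finset.univ (Finset.mem_univ _)
    (fun _ _ _ => Finset.mem_univ _) (fun i (l : E.LineOn i) => l.deg) hbd H
  refine ⟨x, ?_⟩
  convert hx

end VectorBundle

end RationalTree

/-! ### Gluing line subbundles -/

namespace RationalTree

namespace VectorBundle

open Filter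

variable {k : Type u} [Field k] {C : RationalTree k} {r : ℕ}

/-- Line subbundles along the components that agree at the nodes form a line subbundle, trivialized
near each point by a coordinate of `E` that does not vanish on the line. -/
theorem exists_isSubbundle_of_lineOn (E : VectorBundle C r) (l : ∀ i, E.LineOn i)
    (hl : ∀ i j p, p ∈ Set.range (C.param i) → p ∈ Set.range (C.param j) →
      (l i).line p = (l j).line p) :
    ∃ (L : VectorBundle C 1) (j : ∀ p, L.fib p →ₗ[k] E.fib p),
      L.IsSubbundle E j ∧ L.HasDegree (∑ i, (l i).deg) := by
  classical
  choose comp hcomp using C.param_cover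
  let M : ∀ p, Submodule k (E.fib p) := fun p => (l (comp p)).line p
  have hM : ∀ i x hx, M (C.param i (P1.mk x hx)) = Submodule.span k {(l i).sec x hx} := by
    intro i x hx
    rw [← (l i).line_param]
    exact hl _ _ _ (hcomp _) ⟨_, rfl⟩
  let base : E.Idx × Fin r → Set C.Pt := fun a =>
    {p | p ∈ E.base a.1 ∧ ∃ v ∈ M p, E.chart a.1 p v a.2 ≠ 0}
  have hbase : ∀ a i x hx, C.param i (P1.mk x hx) ∈ base a ↔
      C.param i (P1.mk x hx) ∈ E.base a.1 ∧ E.chart a.1 _ ((l i).sec x hx) a.2 ≠ 0 := by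
    intro a i x hx
    refine and_congr_right fun _ => ?_
    rw [hM]
    constructor
    · rintro ⟨v, hv, hv0⟩ h
      obtain ⟨c, rfl⟩ := Submodule.mem_span_singleton.1 hv
      exact hv0 (by rw [map_smul, Pi.smul_apply, h, smul_zero])
    · exact fun h => ⟨_, Submodule.mem_span_singleton_self _, h⟩
  have hopen : ∀ a, IsOpen (base a) := by
    intro a
    refine isOpen_iff.2 fun i => isOpen_iff_mem_nhds.2 fun q hq => ?_
    obtain ⟨x, hx, rfl⟩ := P1.exists_mk q
    obtain ⟨h1, h2⟩ := (hbase a i x hx).1 hq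
    filter_upwards [E.eventually_mem_base h1,
      (((l i).isHomSection a.1 _ h1 a.2).inv h2).2] with q hq1 hq2
    obtain ⟨y, hy, rfl⟩ := P1.exists_mk q
    exact (hbase a i y hy).2 ⟨hq1, hq2 y hy rfl⟩
  have hev : ∀ {a i q}, C.param i q ∈ base a → ∀ᶠ q' in 𝓝 q, C.param i q' ∈ base a :=
    fun {a i q} h => (isOpen_iff.1 (hopen a) i).mem_nhds h
  have hcover : ∀ p, ∃ a, p ∈ base a := by
    intro p
    obtain ⟨q, hq⟩ := hcomp p
    obtain ⟨x, hx, rfl⟩ := P1.exists_mk q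
    obtain ⟨a, ha⟩ := E.base_cover p
    obtain ⟨j, hj⟩ := Function.ne_iff.1
      ((E.chart a _).map_eq_zero_iff.not.2 ((l (comp p)).sec_ne_zero x hx))
    exact ⟨(a, j), hq ▸ (hbase _ _ _ _).2 ⟨hq.symm ▸ ha, hj⟩⟩
  have hchart : ∀ a p, ∃ e : M p ≃ₗ[k] (Fin 1 → k), p ∈ base a →
      ∀ v, e v 0 = E.chart a.1 p v a.2 := by
    intro a p
    have hrank : Module.finrank k (M p) = 1 := by
      obtain ⟨q, hq⟩ := hcomp p
      obtain ⟨x, hx, rfl⟩ := P1.exists_mk q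
      rw [← hq, hM]
      exact finrank_span_singleton ((l _).sec_ne_zero x hx)
    have hfin : Module.Finite k (M p) := Module.finite_of_finrank_eq_succ hrank
    by_cases hp : p ∈ base a
    · obtain ⟨-, w, hw, hw0⟩ := id hp
      let f : M p →ₗ[k] (Fin 1 → k) := LinearMap.pi fun _ =>
        (LinearMap.proj a.2).comp ((E.chart a.1 p).toLinearMap.comp (M p).subtype)
      have hf : Function.Surjective f := by
        intro y
        refine ⟨(y 0 / E.chart a.1 p w a.2) • ⟨w, hw⟩, funext fun m => ?_⟩
        rw [Subsingleton.elim m 0]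
        simp [f, hw0]
      have hinj : Function.Injective f :=
        (LinearMap.injective_iff_surjective_of_finrank_eq_finrank (by simp [hrank])).2 hf
      exact ⟨LinearEquiv.ofBijective f ⟨hinj, hf⟩, fun _ v => rfl⟩
    · exact ⟨LinearEquiv.ofFinrankEq _ _ (by simp [hrank]), fun h => absurd h hp⟩
  choose e he using hchart
  -- A vector of the line is its coordinate times the normalized value of the section
  have hsmul : ∀ a i x hx, C.param i (P1.mk x hx) ∈ base a →
      ∀ v : M (C.param i (P1.mk x hx)),
        (v : E.fib _) = (e a _ v 0 * (E.chart a.1 _ ((l i).sec x hx) a.2)⁻¹) • (l i).sec x hx := by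
    intro a i x hx ha v
    rw [he a _ ha]
    have h := ((hbase a i x hx).1 ha).2
    have hv : (v : E.fib _) ∈ Submodule.span k {(l i).sec x hx} := by
      rw [← hM]
      exact v.2
    obtain ⟨c, hc⟩ := Submodule.mem_span_singleton.1 hv
    rw [← hc, map_smul, Pi.smul_apply, smul_eq_mul, mul_assoc, mul_inv_cancel₀ h, mul_one]
  have hratio : ∀ (a : E.Idx × Fin r) (b : E.Idx) j i q, C.param i q ∈ base a →
      C.param i q ∈ E.base b → P1.RegularOfDegreeAt 0 (fun x hx =>
        (E.chart a.1 _ ((l i).sec x hx) a.2)⁻¹ * E.chart b _ ((l i).sec x hx) j) q := by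
    intro a b j i q ha hb
    obtain ⟨x, hx, rfl⟩ := P1.exists_mk q
    obtain ⟨h1, h2⟩ := (hbase a i x hx).1 ha
    have := (((l i).isHomSection a.1 _ h1 a.2).inv h2).1.mul ((l i).isHomSection b _ hb j)
    rwa [neg_add_cancel] at this
  let L : VectorBundle C 1 :=
    { fib := fun p => M p
      Idx := E.Idx × Fin r
      base := base
      isOpen_base := hopen
      base_cover := hcover
      chart := e
      regular_transition := by
        rintro a b p ha hb m m' i q rfl
        rw [Subsingleton.elim m 0, Subsingleton.elim m' 0]
        refine (hratio a b.1 b.2 i q ha hb.1).congr ?_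
        filter_upwards [hev ha, hev hb] with y hya hyb x hx hxy
        subst hxy
        rw [he b _ hyb, hsmul a i x hx hya ((e a _).symm (Pi.single 0 1)),
          LinearEquiv.apply_symm_apply, map_smul, Pi.smul_apply, smul_eq_mul]
        simp }
  refine ⟨L, fun p => (M p).subtype, ⟨?_, fun p => (M p).injective_subtype⟩,
    fun i => (l i).deg, fun i => ?_, rfl⟩
  · rintro t p ht b hb j i q rfl
    obtain ⟨a, ha⟩ := hcover (C.param i q)
    have h1 : P1.RegularAt _ _ := ht a ha 0 i q rfl
    have h2 := P1.RegularOfDegreeAt.mul h1 (hratio a b j i q ha hb)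
    rw [zero_add] at h2
    refine h2.congr ?_
    filter_upwards [hev ha] with y hya x hx hxy
    subst hxy
    refine (congrArg (fun v => E.chart b _ v j) (hsmul a i x hx hya (t _))).trans ?_
    rw [map_smul, Pi.smul_apply, smul_eq_mul, mul_assoc]
  · refine ⟨fun x hx => ⟨(l i).sec x hx, (hM i x hx).symm ▸ Submodule.mem_span_singleton_self _⟩,
      fun x hx h => (l i).sec_ne_zero x hx (congrArg Subtype.val h), fun a q ha => ?_⟩
    refine ((l i).isHomSection a.1 q ha.1 a.2).congr ?_
    filter_upwards [hev ha] with y hya x hx hxy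
    subst hxy
    exact he a _ hya _

end VectorBundle

end RationalTree

/-! ### Inserting lines at all nodes -/

namespace P1

variable {k : Type u} [Field k]

/-- The point `[1 : 0]`. -/
def zeroPt (k : Type u) [Field k] : P1 k := mk ![1, 0] fun h => by simpa using congrFun h 0

/-- The point `[0 : 1]`. -/
def inftyPt (k : Type u) [Field k] : P1 k := mk ![0, 1] fun h => by simpa using congrFun h 1

theorem zeroPt_ne_inftyPt : zeroPt k ≠ inftyPt k := by
  intro h
  obtain ⟨c, -, hc⟩ := (mk_eq_mk_iff _ _).1 h
  simpa using congrFun hc 0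

theorem isAutomorphism_refl : IsAutomorphism (Equiv.refl (P1 k)) :=
  ⟨⟨continuous_id, fun _ _ h => h⟩, ⟨continuous_id, fun _ _ h => h⟩⟩

end P1

namespace RationalTree

variable {k : Type u} [Field k] {C : RationalTree k}

theorem continuous_param (C : RationalTree k) (i : C.Comp) : Continuous (C.param i) :=
  continuous_def.2 fun _ hs => isOpen_iff.1 hs i

namespace Rooting

variable (ρ : C.Rooting)

/-- The underlying set of the curve obtained by inserting a projective line at each node: the
points `(p, t)` such that `p` is a node or `t = [1 : 0]`. -/
def InsertPt (ρ : C.Rooting) : Type u :=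
  {x : C.Pt × P1 k // (∃ c, c ≠ ρ.root ∧ ρ.node c = x.1) ∨ x.2 = P1.zeroPt k}

/-- The end, on the line inserted at the point `p` of the `i`-th component, at which that
component is attached: `[0 : 1]` if `p` is the node at which a child of `i` meets it, and `[1 : 0]`
otherwise. -/
noncomputable def endPt (i : C.Comp) (p : C.Pt) : P1 k :=
  open Classical in
  if ∃ c, c ≠ ρ.root ∧ ρ.node c = p ∧ ρ.par c = i then P1.inftyPt k else P1.zeroPt k

theorem endPt_node {c : C.Comp} (hc : c ≠ ρ.root) : ρ.endPt c (ρ.node c) = P1.zeroPt k := by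
  refine if_neg ?_
  rintro ⟨c', hc', h, h'⟩
  obtain rfl := ρ.node_injective hc' hc h
  exact ρ.par_ne hc h'

theorem endPt_par_node {c : C.Comp} (hc : c ≠ ρ.root) :
    ρ.endPt (ρ.par c) (ρ.node c) = P1.inftyPt k :=
  if_pos ⟨c, hc, rfl, rfl⟩

/-- The components of the curve obtained by inserting a projective line at each node: those of `C`
and the inserted lines, a node being named by the component below it. -/
noncomputable def insertParam : C.Comp ⊕ {c // c ≠ ρ.root} → P1 k → ρ.InsertPt
  | Sum.inl i, q => ⟨(C.param i q, ρ.endPt i (C.param i q)), by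
      by_cases h : ∃ c, c ≠ ρ.root ∧ ρ.node c = C.param i q ∧ ρ.par c = i
      · obtain ⟨c, hc, h, -⟩ := h
        exact Or.inl ⟨c, hc, h⟩
      · exact Or.inr (if_neg h)⟩
  | Sum.inr c, t => ⟨(ρ.node c, t), Or.inl ⟨c, c.2, rfl⟩⟩

theorem insertParam_inl_inter (i j : C.Comp) (hij : i ≠ j) :
    ¬ (Set.range (ρ.insertParam (Sum.inl i)) ∩ Set.range (ρ.insertParam (Sum.inl j))).Nonempty := by
  rintro ⟨x, ⟨q, hq⟩, ⟨q', hq'⟩⟩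
  have h1 := congrArg (fun y => y.1.1) (hq'.trans hq.symm)
  have h2 := congrArg (fun y => y.1.2) (hq'.trans hq.symm)
  simp only [insertParam] at h1 h2
  rw [h1] at h2
  rcases ρ.eq_par_of_mem hij ⟨q, rfl⟩ ⟨q', h1⟩ with ⟨hi, rfl, h3⟩ | ⟨hj, rfl, h3⟩
  · rw [h3, ρ.endPt_node hi, ρ.endPt_par_node hi] at h2
    exact P1.zeroPt_ne_inftyPt h2.symm
  · rw [h3, ρ.endPt_node hj, ρ.endPt_par_node hj] at h2
    exact P1.zeroPt_ne_inftyPt h2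

theorem insertParam_inr_inter (c c' : {c // c ≠ ρ.root}) (h : c ≠ c') :
    ¬ (Set.range (ρ.insertParam (Sum.inr c)) ∩
      Set.range (ρ.insertParam (Sum.inr c'))).Nonempty := by
  rintro ⟨x, ⟨q, hq⟩, ⟨q', hq'⟩⟩
  have h1 : ρ.node c = ρ.node c' := congrArg (fun y => y.1.1) (hq.trans hq'.symm)
  exact h (Subtype.ext (ρ.node_injective c.2 c'.2 h1))

theorem insertParam_injective (i : C.Comp ⊕ {c // c ≠ ρ.root}) :
    Function.Injective (ρ.insertParam i) := by
  intro q q' h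
  rcases i with i | c
  · exact C.param_injective i (congrArg (fun y => y.1.1) h)
  · exact congrArg (fun y => y.1.2) h

theorem insertParam_inl_inr_subsingleton (i : C.Comp) (c : {c // c ≠ ρ.root}) :
    (Set.range (ρ.insertParam (Sum.inl i)) ∩
      Set.range (ρ.insertParam (Sum.inr c))).Subsingleton := by
  rintro _ ⟨⟨q, rfl⟩, ⟨t, ht⟩⟩ _ ⟨⟨q', rfl⟩, ⟨t', ht'⟩⟩
  have h1 : ρ.node c = C.param i q := congrArg (fun y => y.1.1) ht
  have h2 : ρ.node c = C.param i q' := congrArg (fun y => y.1.1) ht'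
  rw [C.param_injective i (h1.symm.trans h2)]

/-- The parents in the curve obtained by inserting lines at the nodes: the inserted line lies between
the two components that met at the node. -/
noncomputable def insertPar : C.Comp ⊕ {c // c ≠ ρ.root} → C.Comp ⊕ {c // c ≠ ρ.root}
  | Sum.inl i => open Classical in if h : i ≠ ρ.root then Sum.inr ⟨i, h⟩ else Sum.inl i
  | Sum.inr c => Sum.inl (ρ.par c)

theorem insertPar_inl {i : C.Comp} (hi : i ≠ ρ.root) :
    ρ.insertPar (Sum.inl i) = Sum.inr ⟨i, hi⟩ := dif_pos hi

/-- The depth in the curve obtained by inserting lines at the nodes. -/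
def insertDepth : C.Comp ⊕ {c // c ≠ ρ.root} → ℕ
  | Sum.inl i => 2 * ρ.depth i
  | Sum.inr c => 2 * ρ.depth (ρ.par c) + 1

theorem insertParam_inl_inr {i : C.Comp} {c : {c // c ≠ ρ.root}} {q t : P1 k}
    (h : ρ.insertParam (Sum.inl i) q = ρ.insertParam (Sum.inr c) t) :
    (i = c ∧ t = P1.zeroPt k) ∨ (i = ρ.par c ∧ t = P1.inftyPt k) := by
  have h1 : C.param i q = ρ.node c := congrArg (fun y => y.1.1) h
  have h2 : ρ.endPt i (C.param i q) = t := congrArg (fun y => y.1.2) h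
  rw [h1] at h2
  rcases ρ.eq_or_eq_par_of_node_mem c.2 ⟨q, h1⟩ with rfl | rfl
  · exact Or.inl ⟨rfl, by rw [← h2, ρ.endPt_node c.2]⟩
  · exact Or.inr ⟨rfl, by rw [← h2, ρ.endPt_par_node c.2]⟩

theorem insert_isRooted :
    (SimpleGraph.fromRel fun i j => (Set.range (ρ.insertParam i) ∩
      Set.range (ρ.insertParam j)).Nonempty).IsRooted (Sum.inl ρ.root) ρ.insertPar
      ρ.insertDepth where
  depth_lt := by
    rintro (i | c) hi
    · have hi' : i ≠ ρ.root := fun h => hi (by rw [h])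
      have := ρ.depth_lt hi'
      simp only [ρ.insertPar_inl hi', insertDepth]
      omega
    · simp [insertPar, insertDepth]
  adj_par := by
    rintro (i | c) hi
    · have hi' : i ≠ ρ.root := fun h => hi (by rw [h])
      rw [ρ.insertPar_inl hi']
      obtain ⟨q, hq⟩ := ρ.node_mem i hi'
      refine ⟨by simp, Or.inl ⟨_, ⟨q, rfl⟩, ⟨P1.zeroPt k, Subtype.ext ?_⟩⟩⟩
      simp only [insertParam, hq, ρ.endPt_node hi']
    · obtain ⟨q, hq⟩ := ρ.node_mem_par c c.2
      refine ⟨by simp [insertPar], Or.inr ⟨ρ.insertParam (Sum.inl (ρ.par c)) q, ⟨q, rfl⟩,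
        ⟨P1.inftyPt k, Subtype.ext ?_⟩⟩⟩
      simp only [insertParam, hq, ρ.endPt_par_node c.2]
  eq_par := by
    intro a b ⟨hne, h⟩
    have h' : (Set.range (ρ.insertParam a) ∩ Set.range (ρ.insertParam b)).Nonempty :=
      h.elim id fun h => Set.inter_comm _ _ ▸ h
    rcases a with i | c <;> rcases b with j | c'
    · exact absurd h' (ρ.insertParam_inl_inter _ _ fun h => hne (by rw [h]))
    · obtain ⟨_, ⟨q, rfl⟩, ⟨t, ht⟩⟩ := h'
      rcases ρ.insertParam_inl_inr ht.symm with ⟨rfl, -⟩ | ⟨rfl, -⟩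
      · exact Or.inl ⟨fun h => c'.2 (Sum.inl_injective h), (ρ.insertPar_inl c'.2).symm⟩
      · exact Or.inr ⟨by simp, rfl⟩
    · obtain ⟨_, ⟨t, ht⟩, ⟨q, rfl⟩⟩ := h'
      rcases ρ.insertParam_inl_inr ht.symm with ⟨rfl, -⟩ | ⟨rfl, -⟩
      · exact Or.inr ⟨fun h => c.2 (Sum.inl_injective h), (ρ.insertPar_inl c.2).symm⟩
      · exact Or.inl ⟨by simp, rfl⟩
    · exact absurd h' (ρ.insertParam_inr_inter _ _ fun h => hne (by rw [h]))

open Classical in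
/-- The tree of smooth rational curves obtained from `C` by inserting a projective line at each
node. -/
noncomputable def insertLines : RationalTree k where
  Pt := ρ.InsertPt
  Comp := C.Comp ⊕ {c // c ≠ ρ.root}
  param := ρ.insertParam
  param_injective := ρ.insertParam_injective
  param_cover := by
    rintro ⟨⟨p, t⟩, h⟩
    by_cases hp : ∃ c, c ≠ ρ.root ∧ ρ.node c = p
    · obtain ⟨c, hc, rfl⟩ := hp
      exact ⟨Sum.inr ⟨c, hc⟩, t, rfl⟩
    · obtain rfl := h.resolve_left hp
      obtain ⟨i, q, rfl⟩ := C.param_cover p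
      refine ⟨Sum.inl i, q, Subtype.ext (Prod.ext rfl (if_neg ?_))⟩
      rintro ⟨c, hc, hcp, -⟩
      exact hp ⟨c, hc, hcp⟩
  inter_subsingleton := by
    rintro (i | c) (j | c') hij
    · exact (Set.not_nonempty_iff_eq_empty.1
        (ρ.insertParam_inl_inter i j fun h => hij (by rw [h]))) ▸ Set.subsingleton_empty
    · exact ρ.insertParam_inl_inr_subsingleton i c'
    · rw [Set.inter_comm]
      exact ρ.insertParam_inl_inr_subsingleton j c
    · exact (Set.not_nonempty_iff_eq_empty.1
        (ρ.insertParam_inr_inter c c' fun h => hij (by rw [h]))) ▸ Set.subsingleton_empty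
  dualGraph_isTree := ρ.insert_isRooted.isTree

/-- The morphism contracting the inserted lines. -/
noncomputable def contraction : Hom ρ.insertLines C where
  toFun x := x.1.1
  continuous_toFun := by
    refine continuous_iSup_dom.2 fun i => continuous_coinduced_dom.2 ?_
    rcases i with i | c
    · exact C.continuous_param i
    · exact continuous_const
  regular_comp := by
    rintro φ _ hφ (i | c) q rfl
    · exact hφ i q rfl
    · exact P1.regularAt_const (φ (ρ.node c)) q

theorem contraction_isEnlargement : ρ.contraction.IsEnlargement := by
  refine ⟨fun p => ?_, ?_⟩
  · obtain ⟨i, q, rfl⟩ := C.param_cover p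
    exact ⟨ρ.insertParam (Sum.inl i) q, rfl⟩
  · rintro (i | c)
    · exact Or.inr ⟨i, Equiv.refl _, P1.isAutomorphism_refl, fun _ => rfl⟩
    · exact Or.inl ⟨ρ.node c, fun _ => rfl⟩

theorem contraction_insertsLinesAtNodes : ρ.contraction.InsertsLinesAtNodes := by
  intro p
  by_cases hp : ∃ c, c ≠ ρ.root ∧ ρ.node c = p
  · obtain ⟨c, hc, rfl⟩ := hp
    refine Or.inr ⟨⟨c, ρ.par c, (ρ.par_ne hc).symm, ρ.node_mem c hc, ρ.node_mem_par c hc⟩,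
      Sum.inr ⟨c, hc⟩, Set.ext fun x => ⟨fun hx => ?_, ?_⟩⟩
    · exact ⟨x.1.2, Subtype.ext (Prod.ext (Eq.symm hx) rfl)⟩
    · rintro ⟨t, rfl⟩
      rfl
  · refine Or.inl ⟨⟨(p, P1.zeroPt k), Or.inr rfl⟩, rfl, ?_⟩
    rintro ⟨⟨p', t⟩, h⟩ rfl
    exact Subtype.ext (Prod.ext rfl (h.resolve_left hp))

end Rooting

/-! ### Line subbundles of the pullback -/

namespace Rooting

variable (ρ : C.Rooting) {r : ℕ} {E : VectorBundle C r}

/-- A line subbundle along a component of `C`, seen along the corresponding component of the curve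
obtained by inserting lines at the nodes. -/
def pullbackLineOn {i : C.Comp} (l : E.LineOn i) :
    (VectorBundle.pullback ρ.contraction E).LineOn (Sum.inl i) where
  deg := l.deg
  sec := l.sec
  isHomSection := l.isHomSection
  sec_ne_zero := l.sec_ne_zero

theorem pullbackLineOn_line {i : C.Comp} (l : E.LineOn i) {p : ρ.insertLines.Pt}
    (hp : p ∈ Set.range (ρ.insertLines.param (Sum.inl i))) :
    (ρ.pullbackLineOn l).line p = l.line (ρ.contraction.toFun p) := by
  obtain ⟨q, rfl⟩ := hp
  obtain ⟨x, hx, rfl⟩ := P1.exists_mk q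
  exact ((ρ.pullbackLineOn l).line_param x hx).trans (l.line_param x hx).symm

/-- Along an inserted line, two lines in the fibre at the node are joined by a line subbundle of the
pullback that is trivial if they agree and of degree `-1` otherwise. -/
theorem exists_lineOn_inr (c : {c // c ≠ ρ.root}) {u w : E.fib (ρ.node c)} (hu : u ≠ 0)
    (hw : w ≠ 0) :
    ∃ l : (VectorBundle.pullback ρ.contraction E).LineOn (Sum.inr c),
      l.deg = -(open Classical in
        if Submodule.span k {u} ≠ Submodule.span k {w} then (1 : ℤ) else 0) ∧
      l.line (ρ.insertLines.param (Sum.inr c) (P1.zeroPt k)) =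
        (Submodule.span k {u} : Submodule k (E.fib (ρ.node c))) ∧
      l.line (ρ.insertLines.param (Sum.inr c) (P1.inftyPt k)) =
        (Submodule.span k {w} : Submodule k (E.fib (ρ.node c))) := by
  by_cases h : Submodule.span k {u} = Submodule.span k {w}
  · let l : (VectorBundle.pullback ρ.contraction E).LineOn (Sum.inr c) :=
      { deg := 0
        sec := fun _ _ => u
        isHomSection := fun a q _ j => P1.regularAt_const (E.chart a (ρ.node c) u j) q
        sec_ne_zero := fun _ _ => hu }
    refine ⟨l, by simp [h, l], l.line_param _ _, (l.line_param _ _).trans h⟩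
  · have hreg : ∀ (a b : k) (q : P1 k),
        P1.RegularOfDegreeAt (-(-1)) (fun x _ => x 0 * a + x 1 * b) q := by
      intro a b q
      have h1 := P1.regularOfDegreeAt_eval
        ((MvPolynomial.isHomogeneous_C_mul_X a (0 : Fin 2)).add
          (MvPolynomial.isHomogeneous_C_mul_X b (1 : Fin 2))) q
      refine h1.congr (Filter.Eventually.of_forall fun _ x _ _ => ?_)
      simp [mul_comm]
    let l : (VectorBundle.pullback ρ.contraction E).LineOn (Sum.inr c) :=
      { deg := -1
        sec := fun x _ => (x 0 • u + x 1 • w : E.fib (ρ.node c))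
        isHomSection := fun a q _ j => by
          refine (hreg (E.chart a (ρ.node c) u j) (E.chart a (ρ.node c) w j) q).congr
            (Filter.Eventually.of_forall fun _ x _ _ => ?_)
          change E.chart a (ρ.node c) (x 0 • u + x 1 • w) j = _
          simp
        sec_ne_zero := fun x hx h0 => by
          change x 0 • u + x 1 • w = 0 at h0
          by_cases hx1 : x 1 = 0
          · rw [hx1, zero_smul, add_zero, smul_eq_zero, or_iff_left hu] at h0
            exact hx (funext fun i => by fin_cases i <;> simp [h0, hx1])
          · have hx0 : x 0 ≠ 0 := by
              intro hx0
              rw [hx0, zero_smul, zero_add, smul_eq_zero] at h0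
              exact h0.elim hx1 hw
            refine h ?_
            rw [← Submodule.span_singleton_smul_eq (IsUnit.mk0 _ hx0) u, eq_neg_of_add_eq_zero_left h0,
              ← neg_smul, Submodule.span_singleton_smul_eq (IsUnit.mk0 _ (neg_ne_zero.2 hx1)) w] }
    have hzero : ((1 : k) • u + (0 : k) • w : E.fib (ρ.node c)) = u := by simp
    have hinfty : ((0 : k) • u + (1 : k) • w : E.fib (ρ.node c)) = w := by simp
    refine ⟨l, by simp [h, l], (l.line_param _ _).trans ?_, (l.line_param _ _).trans ?_⟩
    · exact congrArg (fun v : E.fib (ρ.node c) => Submodule.span k {v}) hzero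
    · exact congrArg (fun v : E.fib (ρ.node c) => Submodule.span k {v}) hinfty

end Rooting

theorem VectorBundle.LineOn.exists_line_eq_span {r : ℕ} {E : VectorBundle C r} {i : C.Comp}
    (l : E.LineOn i) {p : C.Pt} (hp : p ∈ Set.range (C.param i)) :
    ∃ u : E.fib p, u ≠ 0 ∧ l.line p = Submodule.span k {u} := by
  obtain ⟨q, rfl⟩ := hp
  obtain ⟨x, hx, rfl⟩ := P1.exists_mk q
  exact ⟨l.sec x hx, l.sec_ne_zero x hx, l.line_param x hx⟩

end RationalTree

theorem lemma3p1 {k : Type u} [Field k] [IsAlgClosed k] (C : RationalTree k) {r : ℕ}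
    (E : RationalTree.VectorBundle C r)
    (h₀ : ∀ L : RationalTree.VectorBundle C 1, L.HasDegree 0 → (E.twist L).H0 ≠ ⊥)
    (h₁ : ∃ L : RationalTree.VectorBundle C 1, L.HasDegree (-1) ∧ (E.twist L).H0 = ⊥) :
    ∃ (C' : RationalTree k) (f : RationalTree.Hom C' C),
      f.IsEnlargement ∧ f.InsertsLinesAtNodes ∧
      ∃ (L : RationalTree.VectorBundle C' 1)
        (j : ∀ p, L.fib p →ₗ[k] (RationalTree.VectorBundle.pullback f E).fib p),
        RationalTree.VectorBundle.IsSubbundle L (RationalTree.VectorBundle.pullback f E) j ∧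
        ∃ d : ℤ, 0 ≤ d ∧ L.HasDegree d := by
  classical
  obtain ⟨ρ⟩ := C.nonempty_rooting
  obtain ⟨l, hl⟩ := E.exists_lineOn ρ h₀
  have hjoin : ∀ c : {c // c ≠ ρ.root},
      ∃ l' : (RationalTree.VectorBundle.pullback ρ.contraction E).LineOn (Sum.inr c),
        l'.deg = -(if (l c).line (ρ.node c) ≠ (l (ρ.par c)).line (ρ.node c) then (1 : ℤ) else 0) ∧
        l'.line (ρ.insertLines.param (Sum.inr c) (P1.zeroPt k)) = (l c).line (ρ.node c) ∧
        l'.line (ρ.insertLines.param (Sum.inr c) (P1.inftyPt k)) =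
          (l (ρ.par c)).line (ρ.node c) := by
    intro c
    obtain ⟨u, hu, hu'⟩ := (l c).exists_line_eq_span (ρ.node_mem c c.2)
    obtain ⟨w, hw, hw'⟩ := (l (ρ.par c)).exists_line_eq_span (ρ.node_mem_par c c.2)
    obtain ⟨l', h1, h2, h3⟩ := ρ.exists_lineOn_inr c hu hw
    refine ⟨l', ?_, h2.trans hu'.symm, h3.trans hw'.symm⟩
    rw [hu', hw', h1]
  choose m hm hm0 hm1 using hjoin
  let l' : ∀ i : ρ.insertLines.Comp,
      (RationalTree.VectorBundle.pullback ρ.contraction E).LineOn i := fun i =>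
    Sum.rec (fun i => ρ.pullbackLineOn (l i)) (fun c => m c) i
  have hmix : ∀ i c p, p ∈ Set.range (ρ.insertLines.param (Sum.inl i)) →
      p ∈ Set.range (ρ.insertLines.param (Sum.inr c)) →
      (l' (Sum.inl i)).line p = (l' (Sum.inr c)).line p := by
    rintro i c _ hp ⟨t, rfl⟩
    refine (ρ.pullbackLineOn_line (l i) hp).trans ?_
    obtain ⟨q, hq⟩ := hp
    rcases ρ.insertParam_inl_inr hq with ⟨rfl, rfl⟩ | ⟨rfl, rfl⟩
    · exact (hm0 c).symm
    · exact (hm1 c).symm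
  obtain ⟨L, j, hLj, hL⟩ := RationalTree.VectorBundle.exists_isSubbundle_of_lineOn _ l' (by
    rintro (i | c) (i' | c') p hp hp'
    · by_cases hii : i = i'
      · subst hii
        rfl
      · exact absurd ⟨p, hp, hp'⟩ (ρ.insertParam_inl_inter i i' hii)
    · exact hmix i c' p hp hp'
    · exact (hmix i' c p hp' hp).symm
    · by_cases hcc : c = c'
      · subst hcc
        rfl
      · exact absurd ⟨p, hp, hp'⟩ (ρ.insertParam_inr_inter c c' hcc))
  refine ⟨ρ.insertLines, ρ.contraction, ρ.contraction_isEnlargement,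
    ρ.contraction_insertsLinesAtNodes, L, j, hLj, _, ?_, hL⟩
  have hsum : ∑ i, (l' i).deg = ∑ i, (l i).deg + ∑ c, (m c).deg :=
    Fintype.sum_sum_type fun i => (l' i).deg
  rw [hsum, Finset.sum_congr rfl fun c _ => hm c, Finset.sum_neg_distrib]
  rw [← sub_eq_add_neg, sub_nonneg]
  refine le_trans (le_of_eq ?_) hl
  simp only [ite_and]
  refine Eq.trans ?_ (Finset.sum_filter _ _)
  refine (Finset.sum_subtype (p := fun c => c ≠ ρ.root) (Finset.univ.filter fun c => c ≠ ρ.root) (by simp) fun c =>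
    if (l c).line (ρ.node c) ≠ (l (ρ.par c)).line (ρ.node c) then (1 : ℤ) else 0).symm
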